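/- Let $G$ be a group. A left-preorder on $G$ is a total, transitive, reflexive relation $\preceq$ on $G$ that is left-invariant ($a\preceq b$ implies $ga\preceq gb$ for all $g$) and is not the trivial relation in which all pairs are related; $a\prec b$ means $a\preceq b$ and $b\not\preceq a$. It is relative to the proper subgroup $C=\{g\in G: 1\preceq g\preceq 1\}$, and it is a left-order if it is antisymmetric (equivalently $C=\{1\}$). It is conradian if for all $a,b\succ 1$ there is $n\in\mathbb N$ with $a\prec ba^n$. Let $\mathrm{COrd}(G)$ be the set of conradian left-preorders on $G$ and $\mathrm{COrd}_{\{1\}}(G)$ the subset of those relative to $\{1\}$, that is, of conradian left-orders. Both carry the topology induced from the product topology on $\{1,-1,0\}^G$ (with $\{1,-1,0\}$ discrete) by sending $\preceq$ to the function with value $1$ on $P=\{g: 1\prec g\}$, $-1$ on $P^{-1}$ and $0$ elsewhere. An element of one of these spaces is isolated if its singleton is open in that space. A rational series from $\{1\}$ to $G$ of length $n\ge 0$ is a series of subgroups $\{1\}=G_0\lhd G_1\lhd\dots\lhd G_n=G$, with $G_i$ normal in $G_{i+1}$ and $G_{i+1}/G_i$ torsion-free abelian of rank $1$ for all $0\le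 i<n$. It has an abelian jump if for some $0\le i\le n-2$ the subgroup $G_i$ is normal in $G_{i+2}$ and $G_{i+2}/G_i$ is abelian. Assume that $G$ admits a conradian left-order. Then the following conditions are equivalent: a) some element of $\mathrm{COrd}_{\{1\}}(G)$ is isolated in $\mathrm{COrd}_{\{1\}}(G)$; b) all elements of $\mathrm{COrd}_{\{1\}}(G)$ are isolated in $\mathrm{COrd}_{\{1\}}(G)$; c) all elements of $\mathrm{COrd}(G)$ are isolated in $\mathrm{COrd}(G)$; d) there is a rational series from $\{1\}$ to $G$ without abelian jumps; e) there is exactly one rational series from $\{1\}$ to $G$, and it has no abelian jumps; f) $\mathrm{COrd}_{\{1\}}(G)$ is finite; g) $\mathrm{COrd}(G)$ is finite. Moreover, under these equivalent conditions, $|\mathrm{COrd}(G)|=2^{n+1}-2$ and $|\mathrm{COrd}_{\{1\}}(G)|=2^n$, where $n$ is the length of any series as in d) or e). -/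

import Mathlib

/-- A left-preorder on a group `G`: a total, transitive, reflexive, left-invariant relation on `G`
which is not the trivial relation (the one that relates any two elements). -/
@[ext]
structure LeftPreorder (G : Type*) [Group G] where
  le : G → G → Prop
  le_refl : ∀ a, le a a
  le_trans : ∀ a b c, le a b → le b c → le a c
  le_total : ∀ a b, le a b ∨ le b a
  mul_le_mul_left : ∀ g a b, le a b → le (g * a) (g * b)
  not_trivial : ∃ a b, ¬ le a b

namespace LeftPreorder

variable {G : Type*} [Group G]

/-- The strict relation `a < b`: `a ≤ b` and not `b ≤ a`. -/
def lt (L : LeftPreorder G) (a b : G) : Prop := L.le a b ∧ ¬ L.le b a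

/-- The subgroup `[1] = {g | 1 ≤ g and g ≤ 1}`; `L` is a left-preorder relative to it. -/
def residue (L : LeftPreorder G) : Subgroup G where
  carrier := {g | L.le 1 g ∧ L.le g 1}
  one_mem' := ⟨L.le_refl 1, L.le_refl 1⟩
  mul_mem' := by
    rintro a b ⟨ha, ha'⟩ ⟨hb, hb'⟩
    have h1 := L.mul_le_mul_left a _ _ hb
    have h2 := L.mul_le_mul_left a _ _ hb'
    rw [mul_one] at h1 h2
    exact ⟨L.le_trans _ _ _ ha h1, L.le_trans _ _ _ h2 ha'⟩
  inv_mem' := by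
    rintro a ⟨ha, ha'⟩
    have h1 := L.mul_le_mul_left a⁻¹ _ _ ha
    have h2 := L.mul_le_mul_left a⁻¹ _ _ ha'
    rw [mul_one, inv_mul_cancel] at h1 h2
    exact ⟨h2, h1⟩

/-- A left-order is an antisymmetric left-preorder. -/
def IsLeftOrder (L : LeftPreorder G) : Prop := ∀ a b, L.le a b → L.le b a → a = b

/-- `L` is conradian if for all positive `a`, `b` there is a natural number `n` with
`a < b * a ^ n`. -/
def IsConradian (L : LeftPreorder G) : Prop :=
  ∀ a b, L.lt 1 a → L.lt 1 b → ∃ n : ℕ, L.lt a (b * a ^ n)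

open Classical in
/-- The map `G → {0, 1, -1}` attached to `L`, with value `1` on the positive cone `P`, `-1` on its
inverse `P⁻¹`, and `0` elsewhere. -/
noncomputable def signMap (L : LeftPreorder G) (g : G) : SignType :=
  if L.lt 1 g then 1 else if L.lt 1 g⁻¹ then -1 else 0

/-- The topology induced by `L ↦ L.signMap` from the product topology on `G → {0, 1, -1}`,
where `{0, 1, -1}` is discrete. -/
noncomputable instance instTopologicalSpace : TopologicalSpace (LeftPreorder G) :=
  TopologicalSpace.induced signMap inferInstance

end LeftPreorder

/-- The space `COrd(G)` of conradian left-preorders on `G`. -/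
def COrd (G : Type*) [Group G] : Set (LeftPreorder G) := {L | L.IsConradian}

/-- The space `COrd_C(G)` of conradian left-preorders on `G` relative to the subgroup `C`. -/
def COrdRel (G : Type*) [Group G] (C : Subgroup G) : Set (LeftPreorder G) :=
  {L | L.IsConradian ∧ L.residue = C}

/-- The group `Q` is torsion-free abelian of abelian rank `1`. -/
def IsTorsionFreeAbelianRankOne (Q : Type*) [Group Q] : Prop :=
  IsMulTorsionFree Q ∧ ∃ h : ∀ a b : Q, a * b = b * a,
    letI : CommGroup Q := { (inferInstance : Group Q) with mul_comm := h }
    Module.rank ℤ (Additive Q) = 1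

/-- `H` is a normal subgroup of `K` and `K / H` is torsion-free abelian of rank `1`. -/
structure IsRationalStep {G : Type*} [Group G] (H K : Subgroup G) : Prop where
  le : H ≤ K
  normal : (H.subgroupOf K).Normal
  quotient : IsTorsionFreeAbelianRankOne (K ⧸ H.subgroupOf K)

/-- A finite rational series `G₀ ⊲ G₁ ⊲ ⋯ ⊲ Gₙ` of subgroups of `G`; here `s.length = n`,
`s.head = G₀` and `s.last = Gₙ`. -/
abbrev RationalSeries (G : Type*) [Group G] : Type _ :=
  RelSeries {p : Subgroup G × Subgroup G | IsRationalStep p.1 p.2}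

/-- Some `G_i` is normal in `G_{i+2}` with abelian quotient `G_{i+2} / G_i`. -/
def RationalSeries.HasAbelianJump {G : Type*} [Group G] (s : RationalSeries G) : Prop :=
  ∃ (i : ℕ) (hi : i + 2 ≤ s.length),
    let H : Subgroup G := s.toFun ⟨i, by omega⟩
    let K : Subgroup G := s.toFun ⟨i + 2, by omega⟩
    ∃ _ : (H.subgroupOf K).Normal, ∀ a b : K ⧸ H.subgroupOf K, a * b = b * a

/-- `s` is a rational series `{1} = G₀ ⊲ G₁ ⊲ ⋯ ⊲ Gₙ = G`. -/
def RationalSeries.IsFull {G : Type*} [Group G] (s : RationalSeries G) : Prop :=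
  s.head = ⊥ ∧ s.last = ⊤

/-! In a conradian preorder every positive `f` determines a jump `D ≤ E` of convex subgroups: `D` is
the largest one avoiding `f`, `E` the smallest one containing it. Modulo `D` the preorder on `E` is
archimedean, so `E / D` is abelian by Hölder's argument (`commutator_mem_core`, `exists_isJump`).
Rank one is expressed by a map to `ℚ` that is additive on `E` with kernel `D` (`IsRatHom`).

An isolated order gives a series. Such an order is singled out by a finite set `S` of positive
elements. On a jump `E / D` take a homomorphism `φ` to `ℚ` positive on the elements of `S` in `E`
outside `D` (`exists_ratHom_pos`), order `E` by the sign of `φ`, and reverse the old order on `ker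
φ` outside `D`. All of `S` stays positive, so the order has not changed, which forces `ker φ = D`
(`IsIsolatedCone.isRatHom`). Hence every jump has rank one; with `φ = 0` the same argument shows
that every jump meets `S`. So there are finitely many jumps, and they form a rational series of
convex subgroups. An abelian jump of it would have rank one by the same lemma, yet contain a convex
subgroup strictly in between.

A series without abelian jumps gives finiteness and uniqueness. By `IsRigidSeries.isConvexIn`, each
term is convex for every nontrivial conradian preorder on the next. Such a preorder is therefore a
sign of `φ` together with an arbitrary conradian preorder on the previous term. With the trivial
relation included the counts satisfy `a (i + 1) = 2 * a i + 1`, and for orders `b (i + 1) = 2 * b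
i`. The penultimate term of any other series is the residue of a conradian preorder, so it is the
same subgroup (`IsRatHom.eq_of_isConvexIn`). Finally, finite T1 spaces are discrete. -/

/-! ### Conradian preorders and the convex jump of a positive element. -/

/-- A total, left-invariant, conradian preorder on a group. -/
structure IsConradPreorder (G : Type*) [Group G] [Preorder G] : Prop where
  mul_le : ∀ c a b : G, a ≤ b → c * a ≤ c * b
  total : ∀ a b : G, a ≤ b ∨ b ≤ a
  conrad : ∀ a b : G, 1 < a → 1 < b → ∃ n : ℕ, a < b * a ^ n

namespace IsConradPreorder

variable {G : Type*} [Group G] [Preorder G] (h : IsConradPreorder G)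
include h

theorem lt_of_not_le {a b : G} (hab : ¬ a ≤ b) : b < a :=
  lt_iff_le_not_ge.2 ⟨(h.total a b).resolve_left hab, hab⟩

theorem mul_le_iff (c : G) {a b : G} : c * a ≤ c * b ↔ a ≤ b :=
  ⟨fun H => by simpa using h.mul_le c⁻¹ _ _ H, h.mul_le c a b⟩

theorem mul_lt_iff (c : G) {a b : G} : c * a < c * b ↔ a < b := by
  simp only [lt_iff_le_not_ge, h.mul_le_iff]

theorem mul_lt (c : G) {a b : G} (hab : a < b) : c * a < c * b := (h.mul_lt_iff c).2 hab

theorem le_mul_right (a : G) {b : G} (hb : 1 ≤ b) : a ≤ a * b := by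
  simpa using h.mul_le a _ _ hb

theorem lt_mul_right (a : G) {b : G} (hb : 1 < b) : a < a * b := by
  simpa using h.mul_lt a hb

theorem one_le_inv_mul {a b : G} : 1 ≤ a⁻¹ * b ↔ a ≤ b := by
  rw [← h.mul_le_iff a]; simp

theorem one_lt_inv_mul {a b : G} : 1 < a⁻¹ * b ↔ a < b := by
  rw [← h.mul_lt_iff a]; simp

theorem inv_le_one {a : G} : a⁻¹ ≤ 1 ↔ 1 ≤ a := by
  rw [← h.mul_le_iff a]; simp

theorem one_le_inv {a : G} : 1 ≤ a⁻¹ ↔ a ≤ 1 := by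
  rw [← h.mul_le_iff a]; simp

theorem one_lt_inv {a : G} : 1 < a⁻¹ ↔ a < 1 := by
  rw [← h.mul_lt_iff a]; simp

theorem inv_lt_one {a : G} : a⁻¹ < 1 ↔ 1 < a := by
  rw [← h.mul_lt_iff a]; simp

theorem one_le_pow {a : G} (ha : 1 ≤ a) (n : ℕ) : 1 ≤ a ^ n := by
  induction n with
  | zero => simp
  | succ n ih => rw [pow_succ]; exact ih.trans (h.le_mul_right _ ha)

theorem pow_le_one {a : G} (ha : a ≤ 1) (n : ℕ) : a ^ n ≤ 1 := by
  rw [← h.one_le_inv, ← inv_pow]; exact h.one_le_pow (h.one_le_inv.2 ha) n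

theorem pow_le_pow {a : G} (ha : 1 ≤ a) {m n : ℕ} (hmn : m ≤ n) : a ^ m ≤ a ^ n := by
  obtain ⟨k, rfl⟩ := Nat.exists_eq_add_of_le hmn
  rw [pow_add]; exact h.le_mul_right _ (h.one_le_pow ha k)

theorem pow_lt_pow {a : G} (ha : 1 < a) {m n : ℕ} (hmn : m < n) : a ^ m < a ^ n := by
  refine lt_of_lt_of_le ?_ (h.pow_le_pow ha.le hmn)
  rw [pow_succ]; exact h.lt_mul_right _ ha

/-- In a conradian preorder, the exponent in the definition can be taken to be `2`. -/
theorem le_mul_sq {a b : G} (ha : 1 < a) (hb : 1 < b) : a < b * a ^ 2 := by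
  by_contra hn
  have h1 : b * a ^ 2 ≤ a := by
    by_contra h2; exact hn (h.lt_of_not_le h2)
  have hc : 1 < b * a := hb.trans (h.lt_mul_right _ ha)
  have h2 : ∀ n : ℕ, (b * a) ^ n * a ≤ a := by
    intro n
    induction n with
    | zero => simp
    | succ n ih =>
      rw [pow_succ, mul_assoc]
      refine le_trans (h.mul_le _ _ _ ?_) ih
      rwa [mul_assoc, ← sq]
  -- With `c = b * a` this yields `c < b * c ^ n ≤ b * (c ^ n * a) ≤ b * a = c`.
  obtain ⟨n, hn⟩ := h.conrad _ b hc hb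
  refine lt_irrefl _ (hn.trans_le ?_)
  exact (h.mul_le _ _ _ ((h.le_mul_right _ ha.le).trans (h2 n)))

/-- Apply `le_mul_sq` to `u` and `g⁻¹ * u`, then multiply by `g`. This replaces right monotonicity,
which is not available. -/
theorem mul_lt_cube {u g : G} (hu : 1 < u) (hg : g < u) : g * u < u ^ 3 := by
  have := h.mul_lt g (h.le_mul_sq hu (h.one_lt_inv_mul.2 hg))
  rwa [← mul_assoc, mul_inv_cancel_left, ← pow_succ'] at this

omit h in
/-- A subgroup is convex if it contains with `g` every `x` such that `1 ≤ x ≤ g`. -/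
def IsConvex (K : Subgroup G) : Prop := ∀ x g, 1 ≤ x → x ≤ g → g ∈ K → x ∈ K

/-- The smallest convex subgroup that contains the positive element `f`. -/
def hull {f : G} (hf : 1 < f) : Subgroup G where
  carrier := {g | ∃ n : ℕ, g < f ^ n ∧ g⁻¹ < f ^ n}
  one_mem' := ⟨1, by simpa using hf⟩
  inv_mem' := by rintro g ⟨n, h1, h2⟩; exact ⟨n, h2, by simpa using h1⟩
  mul_mem' := by
    rintro a b ⟨n, h1, h2⟩ ⟨m, h3, h4⟩
    have key : ∀ x y : G, x < f ^ (n + m + 1) → y < f ^ (n + m + 1) →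
        x * y < f ^ ((n + m + 1) * 3) := by
      intro x y hx hy
      rw [pow_mul]
      refine (h.mul_lt x hy).trans (h.mul_lt_cube ?_ hx)
      simpa using h.pow_lt_pow hf (Nat.succ_pos (n + m))
    have up1 := h.pow_le_pow hf.le (show n ≤ n + m + 1 by omega)
    have up2 := h.pow_le_pow hf.le (show m ≤ n + m + 1 by omega)
    -- The `+ 1` makes the bounding power of `f` strictly positive; the factor `3` is the cube in
    -- `mul_lt_cube`.
    refine ⟨(n + m + 1) * 3, key _ _ (h1.trans_le up1) (h3.trans_le up2), ?_⟩
    rw [mul_inv_rev]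
    exact key _ _ (h4.trans_le up2) (h2.trans_le up1)

theorem self_mem_hull {f : G} (hf : 1 < f) : f ∈ h.hull hf :=
  ⟨2, by simpa using h.pow_lt_pow hf (show 1 < 2 by norm_num),
    (h.inv_lt_one.2 hf).trans (by simpa using h.pow_lt_pow hf (show 0 < 2 by norm_num))⟩

theorem isConvex_hull {f : G} (hf : 1 < f) : IsConvex (h.hull hf) := by
  rintro x g hx hxg ⟨n, h1, -⟩
  exact ⟨n, hxg.trans_lt h1, ((h.inv_le_one.2 hx).trans (hx.trans hxg)).trans_lt h1⟩

theorem hull_le {f : G} (hf : 1 < f) {K : Subgroup G} (hK : IsConvex K) (hfK : f ∈ K) :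
    h.hull hf ≤ K := by
  rintro g ⟨n, h1, h2⟩
  rcases h.total 1 g with hg | hg
  · exact hK _ _ hg h1.le (K.pow_mem hfK n)
  · exact K.inv_mem_iff.1 (hK _ _ (h.one_le_inv.2 hg) h2.le (K.pow_mem hfK n))

theorem zpow_lt_of_mem_hull {f m x : G} (hm : 1 < m) (hmf : ∀ n : ℤ, m ^ n < f)
    (hx : x ∈ h.hull hm) (n : ℤ) : x ^ n < f := by
  obtain ⟨k, hk, -⟩ := (h.hull hm).zpow_mem hx n
  exact hk.trans (by simpa using hmf k)

theorem zpow_lt_of_le {f m x : G} (hf : 1 < f) (hmf : ∀ n : ℤ, m ^ n < f)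
    (hx : 1 ≤ x) (hxm : x ≤ m) (n : ℤ) : x ^ n < f := by
  by_cases hm : 1 < m
  · exact h.zpow_lt_of_mem_hull hm hmf
      (h.isConvex_hull hm _ _ hx hxm (h.self_mem_hull hm)) n
  · have hx1 : x ≤ 1 := hxm.trans (by by_contra h2; exact hm (h.lt_of_not_le h2))
    refine lt_of_le_of_lt ?_ hf
    obtain ⟨k, rfl | rfl⟩ := n.eq_nat_or_neg
    · simpa using h.pow_le_one hx1 k
    · rw [zpow_neg, h.inv_le_one, zpow_natCast]; exact h.one_le_pow hx k

/-- Up to inverses `a` and `b` are nonnegative; let `m` be the larger. If `m` is positive, both lie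
in its hull, all of whose elements have powers below `f`. Otherwise both are equivalent to `1`. -/
theorem zpow_mul_lt {f a b : G} (hf : 1 < f) (ha : ∀ n : ℤ, a ^ n < f) (hb : ∀ n : ℤ, b ^ n < f)
    (n : ℤ) : (a * b) ^ n < f := by
  have habs : ∀ a : G, (∀ n : ℤ, a ^ n < f) →
      ∃ a' : G, (a = a' ∨ a = a'⁻¹) ∧ 1 ≤ a' ∧ ∀ n : ℤ, a' ^ n < f := by
    intro a ha
    rcases h.total 1 a with h1 | h1
    · exact ⟨a, Or.inl rfl, h1, ha⟩
    · exact ⟨a⁻¹, by simp, h.one_le_inv.2 h1, fun n => by simpa using ha (-n)⟩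
  obtain ⟨a', haa, ha1, ha'⟩ := habs a ha
  obtain ⟨b', hbb, hb1, hb'⟩ := habs b hb
  obtain ⟨m, hm, ham, hbm⟩ : ∃ m : G, (∀ n : ℤ, m ^ n < f) ∧ a' ≤ m ∧ b' ≤ m := by
    rcases h.total a' b' with h1 | h1
    exacts [⟨b', hb', h1, le_rfl⟩, ⟨a', ha', le_rfl, h1⟩]
  by_cases hm1 : 1 < m
  · refine h.zpow_lt_of_mem_hull hm1 hm ?_ n
    have h1 := h.isConvex_hull hm1 _ _ ha1 ham (h.self_mem_hull hm1)
    have h2 := h.isConvex_hull hm1 _ _ hb1 hbm (h.self_mem_hull hm1)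
    refine mul_mem ?_ ?_
    · rcases haa with rfl | rfl
      exacts [h1, inv_mem h1]
    · rcases hbb with rfl | rfl
      exacts [h2, inv_mem h2]
  · have hm1 : m ≤ 1 := by by_contra h2; exact hm1 (h.lt_of_not_le h2)
    have res : ∀ x : G, 1 ≤ x → x ≤ 1 → 1 ≤ x⁻¹ ∧ x⁻¹ ≤ 1 :=
      fun x h1 h2 => ⟨h.one_le_inv.2 h2, h.inv_le_one.2 h1⟩
    have ha2 : 1 ≤ a ∧ a ≤ 1 := by
      rcases haa with rfl | rfl
      exacts [⟨ha1, ham.trans hm1⟩, res _ ha1 (ham.trans hm1)]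
    have hb2 : 1 ≤ b ∧ b ≤ 1 := by
      rcases hbb with rfl | rfl
      exacts [⟨hb1, hbm.trans hm1⟩, res _ hb1 (hbm.trans hm1)]
    have h3 : a * b ≤ 1 := by
      have := h.mul_le a _ _ hb2.2
      rw [mul_one] at this; exact this.trans ha2.2
    exact h.zpow_lt_of_le hf (m := 1) (by simpa using hf)
      (ha2.1.trans (h.le_mul_right a hb2.1)) h3 n

/-- The largest convex subgroup that does not contain the positive element `f`. -/
def core {f : G} (hf : 1 < f) : Subgroup G where
  carrier := {g | ∀ n : ℤ, g ^ n < f}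
  one_mem' := by simpa using hf
  inv_mem' := by intro g hg n; simpa using hg (-n)
  mul_mem' := by intro a b ha hb n; exact h.zpow_mul_lt hf ha hb n

theorem mem_core {f : G} (hf : 1 < f) {g : G} : g ∈ h.core hf ↔ ∀ n : ℤ, g ^ n < f := Iff.rfl

theorem isConvex_core {f : G} (hf : 1 < f) : IsConvex (h.core hf) :=
  fun _ _ hx hxg hg n => h.zpow_lt_of_le hf hg hx hxg n

theorem core_le_hull {f : G} (hf : 1 < f) : h.core hf ≤ h.hull hf :=
  fun g hg => ⟨1, by simpa using hg 1, by simpa using hg (-1)⟩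

theorem self_notMem_core {f : G} (hf : 1 < f) : f ∉ h.core hf :=
  fun hg => lt_irrefl f (by simpa using hg 1)

theorem mem_of_notMem_core {f x : G} (hf : 1 < f) (hx : x ∉ h.core hf) {K : Subgroup G}
    (hK : IsConvex K) (hxK : x ∈ K) : f ∈ K := by
  simp only [mem_core, not_forall] at hx
  obtain ⟨n, hn⟩ := hx
  refine hK f (x ^ n) hf.le ?_ (K.zpow_mem hxK n)
  by_contra h2; exact hn (h.lt_of_not_le h2)

end IsConradPreorder

/-! ### Hölder's theorem and commutativity of the jumps. -/

namespace IsConradPreorder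

variable {G : Type*} [Group G] [Preorder G] (h : IsConradPreorder G)
include h

section Archimedean

variable (arch : ∀ x y : G, 1 < x → ∃ n : ℕ, y < x ^ n)
include arch

/-- If the conjugate were nonpositive, so would be those of all `x ^ n`, although `x ^ n` eventually
exceeds any given element. From this come right monotonicity and a bi-invariant preorder. -/
theorem one_lt_conj {x : G} (hx : 1 < x) (k : G) : 1 < k⁻¹ * x * k := by
  by_contra hn
  have hn : k⁻¹ * x * k ≤ 1 := by by_contra h2; exact hn (h.lt_of_not_le h2)
  have hz : ∀ n : ℕ, k⁻¹ * x ^ n * k ≤ 1 := fun n => by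
    have h2 := conj_pow (a := k⁻¹) (b := x) (i := n)
    rw [inv_inv] at h2
    rw [← h2]; exact h.pow_le_one hn n
  by_cases hk : 1 ≤ k
  · obtain ⟨n, hn⟩ := arch x k hx
    have h1 := hz n
    rw [← h.mul_le_iff k] at h1
    have h2 : x ^ n * k ≤ k := by simpa [mul_assoc] using h1
    exact lt_irrefl _ (hn.trans_le ((h.le_mul_right _ hk).trans h2))
  · have hl : 1 < k⁻¹ := h.one_lt_inv.2 (h.lt_of_not_le fun h1 => hk h1)
    obtain ⟨n, hn⟩ := arch x (k⁻¹ ^ 2) hx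
    -- With `l = k⁻¹`, the element `l * x ^ n * k` is below `l`, so the cube bound gives `l * x ^ n
    -- < l ^ 3`, against `l ^ 2 < x ^ n`.
    have h1 := h.mul_lt_cube hl ((hz n).trans_lt hl)
    rw [mul_inv_cancel_right, pow_succ', h.mul_lt_iff] at h1
    exact lt_irrefl _ (h1.trans hn)

theorem mul_lt_right {a b : G} (hab : a < b) (c : G) : a * c < b * c := by
  have := h.one_lt_conj arch (h.one_lt_inv_mul.2 hab) c
  rw [← h.one_lt_inv_mul]
  simpa [mul_assoc] using this

theorem mul_le_right {a b : G} (hab : a ≤ b) (c : G) : a * c ≤ b * c := by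
  by_contra hn
  have := h.mul_lt_right arch (h.lt_of_not_le hn) c⁻¹
  simp only [mul_inv_cancel_right] at this
  exact not_lt_of_ge hab this

theorem exists_zpow_le_lt {e : G} (he : 1 < e) (a : G) :
    ∃ m : ℤ, e ^ m ≤ a ∧ a < e ^ (m + 1) := by
  have hmono : ∀ m n : ℤ, e ^ m < e ^ n → m < n := by
    intro m n hmn
    by_contra hle
    obtain ⟨k, rfl⟩ := Int.exists_add_of_le (not_lt.1 hle)
    refine not_lt_of_ge ?_ hmn
    rw [zpow_add, zpow_natCast]
    exact h.le_mul_right _ (h.one_le_pow he.le k)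
  obtain ⟨k, hk⟩ := arch e a he
  obtain ⟨l, hl⟩ := arch e a⁻¹ he
  have hl' : e ^ (-(l : ℤ)) ≤ a := by
    have h1 := h.mul_lt_right arch hl a
    rw [inv_mul_cancel] at h1
    rw [← h.mul_le_iff (e ^ (l : ℤ))]
    simpa using h1.le
  obtain ⟨m, hm, hmax⟩ := Int.exists_greatest_of_bdd (P := fun m : ℤ => e ^ m ≤ a)
    ⟨k, fun m hm => (hmono m k (hm.trans_lt (by simpa using hk))).le⟩ ⟨_, hl'⟩
  refine ⟨m, hm, h.lt_of_not_le fun hle => ?_⟩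
  have := hmax _ hle
  omega

/-- Suppose the commutator `c` is positive. If `e ^ 2 ≤ c` with `e` positive, enclosing `a` and `b`
between consecutive powers of `e` gives `a * b < b * a * e ^ 2`, hence `c < e ^ 2`, a contradiction.
-/
theorem mul_le_mul_comm (a b : G) : a * b ≤ b * a := by
  by_contra hn
  have hc : 1 < (b * a)⁻¹ * (a * b) := h.one_lt_inv_mul.2 (h.lt_of_not_le hn)
  set c := (b * a)⁻¹ * (a * b) with hcdef
  by_cases hex : ∃ e : G, 1 < e ∧ e ^ 2 ≤ c
  · obtain ⟨e, he, hec⟩ := hex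
    obtain ⟨m, hm, hm'⟩ := h.exists_zpow_le_lt arch he a
    obtain ⟨n, hn1, hn'⟩ := h.exists_zpow_le_lt arch he b
    have h1 : a * b < e ^ (m + 1) * e ^ (n + 1) :=
      (h.mul_lt a hn').trans (h.mul_lt_right arch hm' _)
    have h2 : e ^ n * e ^ m ≤ b * a := (h.mul_le _ _ _ hm).trans (h.mul_le_right arch hn1 _)
    have h3 : e ^ (m + 1) * e ^ (n + 1) = e ^ n * e ^ m * e ^ 2 := by
      rw [← zpow_natCast e 2, ← zpow_add, ← zpow_add, ← zpow_add]; congr 1; push_cast; ring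
    have h4 : a * b < b * a * e ^ 2 := by
      rw [h3] at h1; exact h1.trans_le (h.mul_le_right arch h2 _)
    have h5 : c < e ^ 2 := by
      rw [← h.mul_lt_iff (b * a), hcdef, mul_inv_cancel_left]; exact h4
    exact not_lt_of_ge hec h5
  -- Now `c` is least positive: for `1 < x < c`, the smaller of `x` and `x⁻¹ * c` would have square
  -- at most `c`. So every element is equivalent to a power of `c`, and powers commute.
  · push Not at hex
    have hmin : ∀ x : G, 1 < x → c ≤ x := by
      intro x hx
      by_contra hcx
      have hxc := h.lt_of_not_le hcx
      have hy : 1 < x⁻¹ * c := h.one_lt_inv_mul.2 hxc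
      rcases h.total x (x⁻¹ * c) with h1 | h1
      · refine hex x hx ?_
        have := h.mul_le x _ _ h1
        rwa [mul_inv_cancel_left, ← sq] at this
      · refine hex _ hy ?_
        have := h.mul_le_right arch h1 (x⁻¹ * c)
        rwa [mul_inv_cancel_left, ← sq] at this
    have happ : ∀ a : G, ∃ m : ℤ, c ^ m ≤ a ∧ a ≤ c ^ m := by
      intro a
      obtain ⟨m, hm, hm'⟩ := h.exists_zpow_le_lt arch hc a
      refine ⟨m, hm, ?_⟩
      by_contra hle
      have h1 := hmin _ (h.one_lt_inv_mul.2 (h.lt_of_not_le hle))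
      rw [← h.mul_le_iff (c ^ m), mul_inv_cancel_left, ← zpow_add_one] at h1
      exact not_lt_of_ge h1 hm'
    obtain ⟨m, hm, hm'⟩ := happ a
    obtain ⟨n, hn1, hn'⟩ := happ b
    refine hn (((h.mul_le _ _ _ hn').trans (h.mul_le_right arch hm' _)).trans ?_)
    rw [← zpow_add, add_comm, zpow_add]
    exact (h.mul_le _ _ _ hm).trans (h.mul_le_right arch hn1 _)

end Archimedean

theorem one_lt_mul_of_mem {D : Subgroup G} (hD : IsConvex D) {a d : G} (ha : 1 ≤ a)
    (haD : a ∉ D) (hd : d ∈ D) : 1 < a * d := by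
  by_contra hn
  have hn : a * d ≤ 1 := by by_contra h2; exact hn (h.lt_of_not_le h2)
  have h1 := h.mul_le d⁻¹ _ _ (h.inv_le_one.2 ha)
  rw [← mul_inv_rev, mul_one] at h1
  have h2 := hD _ _ (h.one_le_inv.2 hn) h1 (inv_mem hd)
  exact haD ((D.mul_mem_cancel_right hd).1 (D.inv_mem_iff.1 h2))

theorem one_lt_mul_of_mem_left {D : Subgroup G} (hD : IsConvex D) {a d : G} (ha : 1 ≤ a)
    (haD : a ∉ D) (hd : d ∈ D) : 1 < d * a := by
  by_contra hn
  have hn : d * a ≤ 1 := by by_contra h2; exact hn (h.lt_of_not_le h2)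
  have h1 := h.mul_le d⁻¹ _ _ hn
  rw [inv_mul_cancel_left, mul_one] at h1
  exact haD (hD _ _ ha h1 (inv_mem hd))

/-- The preorder obtained by collapsing a convex subgroup `D`. -/
@[reducible]
def collapse {D : Subgroup G} (hD : IsConvex D) : Preorder G where
  le a b := a ≤ b ∨ a⁻¹ * b ∈ D
  lt a b := (a ≤ b ∨ a⁻¹ * b ∈ D) ∧ ¬ (b ≤ a ∨ b⁻¹ * a ∈ D)
  le_refl a := Or.inl le_rfl
  le_trans a b c := by
    have hkey : a⁻¹ * c = (a⁻¹ * b) * (b⁻¹ * c) := by group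
    rintro (h1 | h1) (h2 | h2)
    · exact Or.inl (h1.trans h2)
    · rw [hkey]
      by_cases h3 : a⁻¹ * b ∈ D
      · exact Or.inr (mul_mem h3 h2)
      · rw [← h.one_le_inv_mul, hkey]
        exact Or.inl (h.one_lt_mul_of_mem hD (h.one_le_inv_mul.2 h1) h3 h2).le
    · rw [hkey]
      by_cases h3 : b⁻¹ * c ∈ D
      · exact Or.inr (mul_mem h1 h3)
      · rw [← h.one_le_inv_mul, hkey]
        exact Or.inl (h.one_lt_mul_of_mem_left hD (h.one_le_inv_mul.2 h2) h3 h1).le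
    · rw [hkey]; exact Or.inr (mul_mem h1 h2)

theorem collapse_lt_iff {D : Subgroup G} (hD : IsConvex D) {a b : G} :
    (h.collapse hD).lt a b ↔ a < b ∧ a⁻¹ * b ∉ D := by
  have hab : a⁻¹ * b ∈ D ↔ b⁻¹ * a ∈ D := by rw [← D.inv_mem_iff]; simp
  change ((a ≤ b ∨ a⁻¹ * b ∈ D) ∧ ¬ (b ≤ a ∨ b⁻¹ * a ∈ D)) ↔ _
  rw [lt_iff_le_not_ge, hab]
  tauto

theorem isConradPreorder_collapse {D : Subgroup G} (hD : IsConvex D) :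
    @IsConradPreorder G _ (h.collapse hD) := by
  have hmul : ∀ c a b : G, (h.collapse hD).le a b → (h.collapse hD).le (c * a) (c * b) := by
    rintro c a b (h1 | h1)
    · exact Or.inl (h.mul_le c a b h1)
    · refine Or.inr ?_
      convert h1 using 1
      group
  refine @IsConradPreorder.mk G _ (h.collapse hD) hmul ?_ ?_
  · intro a b
    exact (h.total a b).imp Or.inl Or.inl
  · intro a b ha hb
    -- Exponent `2` works before collapsing; one more factor `a`, which lies outside `D`, makes the
    -- inequality strict modulo `D`.
    refine ⟨3, ?_⟩
    have h1 := (h.le_mul_sq ((h.collapse_lt_iff hD).1 ha).1 ((h.collapse_lt_iff hD).1 hb).1).le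
    have h2 := @lt_of_le_of_lt G (h.collapse hD) a (b * a ^ 2) (b * a ^ 3) (Or.inl h1) ?_
    · exact h2
    · rw [h.collapse_lt_iff hD] at ha ⊢
      have : (b * a ^ 2)⁻¹ * (b * a ^ 3) = a := by group
      rw [← h.one_lt_inv_mul, this]
      simpa using ha

theorem subgroup (K : Subgroup G) : IsConradPreorder K where
  mul_le c a b hab := h.mul_le c a b hab
  total a b := h.total a b
  conrad a b ha hb := h.conrad a b ha hb

/-- The group `hull hf / core hf` is abelian. -/
theorem commutator_mem_core {f : G} (hf : 1 < f) {a b : G} (ha : a ∈ h.hull hf)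
    (hb : b ∈ h.hull hf) : a⁻¹ * b⁻¹ * a * b ∈ h.core hf := by
  have hD := h.isConvex_core hf
  have key : ∀ a b : h.hull hf,
      (h.collapse hD).le ((a * b : h.hull hf) : G) ((b * a : h.hull hf) : G) := by
    have h' := @subgroup G _ (h.collapse hD) (h.isConradPreorder_collapse hD) (h.hull hf)
    refine @mul_le_mul_comm _ _ (@Subtype.preorder G (h.collapse hD) _) h' ?_
    intro x y hx
    have hx' := (h.collapse_lt_iff hD).1 hx
    have hx1 : 1 < (x : G) := hx'.1
    -- This is the archimedean property modulo the core: `x` outside the core has `f`, hence the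
    -- whole hull of `f`, in its own hull.
    have hfx : f ∈ h.hull hx1 :=
      h.mem_of_notMem_core hf (by simpa using hx'.2) (h.isConvex_hull hx1) (h.self_mem_hull hx1)
    obtain ⟨n, hn, -⟩ := h.hull_le hf (h.isConvex_hull hx1) hfx y.2
    refine ⟨n + 1, @lt_of_le_of_lt G (h.collapse hD) y (x ^ n) (x ^ (n + 1)) (Or.inl hn.le) ?_⟩
    have hxx : ((x : G) ^ n)⁻¹ * (x : G) ^ (n + 1) = x := by group
    rw [h.collapse_lt_iff hD, ← h.one_lt_inv_mul, hxx]
    exact ⟨hx1, by simpa using hx'.2⟩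
  have hcomm : a⁻¹ * b⁻¹ * a * b = (b * a)⁻¹ * (a * b) := by group
  have h1 := key ⟨a, ha⟩ ⟨b, hb⟩
  have h2 := key ⟨b, hb⟩ ⟨a, ha⟩
  rw [hcomm]
  rcases h2 with h2 | h2
  · rcases h1 with h1 | h1
    · exact hD _ 1 (h.one_le_inv_mul.2 h2)
        (by rw [← h.mul_le_iff (b * a), mul_inv_cancel_left, mul_one]; exact h1) (one_mem _)
    · rw [← inv_mem_iff]; simpa [mul_assoc] using h1
  · exact h2

end IsConradPreorder

/-! ### Half-spaces over the rational numbers. -/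

/-- A finite subset of an additively closed set that avoids `0` lies in an open half-space over
the rational numbers. -/
theorem exists_addMonoidHom_pos {A : Type*} [AddCommGroup A] (P : Set A)
    (hadd : ∀ a ∈ P, ∀ b ∈ P, a + b ∈ P) (h0 : (0 : A) ∉ P) :
    ∀ (k : ℕ) (s : Fin k → A), (∀ i, s i ∈ P) → ∃ ψ : A →+ ℚ, ∀ i, 0 < ψ (s i) := by
  have hsmul : ∀ n : ℕ, n ≠ 0 → ∀ a ∈ P, n • a ∈ P := by
    intro n hn a ha
    induction n with
    | zero => exact absurd rfl hn
    | succ n ih =>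
      rcases eq_or_ne n 0 with rfl | hn'
      · simpa using ha
      · rw [succ_nsmul]; exact hadd _ (ih hn') _ ha
  intro k
  induction k with
  | zero => exact fun s _ => ⟨0, fun i => i.elim0⟩
  | succ k ih =>
    intro s hs
    rcases Nat.eq_zero_or_pos k with rfl | hk
    · have ha := hs 0
      have hinj : Function.Injective (zmultiplesHom A (s 0)) := by
        rw [injective_iff_map_eq_zero]
        intro n hn
        by_contra hn0
        have h1 : n.natAbs • s 0 ∈ P := hsmul _ (by simpa using hn0) _ ha
        have h2 : n.natAbs • s 0 = 0 := by
          rw [zmultiplesHom_apply] at hn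
          rcases Int.natAbs_eq n with h | h
          · rw [h] at hn; simpa using hn
          · rw [h] at hn; simpa using hn
        exact h0 (h2 ▸ h1)
      -- A single element has infinite order, so the map sending it to `1` extends to `A` because
      -- `ℚ` is divisible.
      obtain ⟨ψ, hψ⟩ := (Module.Baer.of_divisible (A := ℚ)).extension_property_addMonoidHom
        (zmultiplesHom A (s 0)) hinj (Int.castAddHom ℚ)
      refine ⟨ψ, fun i => ?_⟩
      have h1 := DFunLike.congr_fun hψ 1
      simp at h1
      have : i = 0 := by omega
      rw [this, h1]; exact one_pos
    · obtain ⟨ψ, hψ⟩ := ih (fun i => s i.castSucc) (fun i => hs _)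
      rcases lt_or_ge 0 (ψ (s (Fin.last k))) with hpos | hneg
      · exact ⟨ψ, fun i => Fin.lastCases hpos hψ i⟩
      -- Fourier–Motzkin elimination: with `u = -ψ (s (last k)) ≥ 0` and `v = ψ (s i) > 0`, take for
      -- `b` the combination `u • s i + v • s (last k)`, which `ψ` kills, with denominators cleared
      -- so that it lies in `P`.
      have hex : ∀ i : Fin k, ∃ b ∈ P, ∀ χ : A →+ ℚ, 0 < χ b →
          0 < -ψ (s (Fin.last k)) * χ (s i.castSucc) + ψ (s i.castSucc) * χ (s (Fin.last k)) := by
        intro i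
        have hv := hψ i
        have hu : 0 ≤ -ψ (s (Fin.last k)) := by linarith
        set u := -ψ (s (Fin.last k))
        set v := ψ (s i.castSucc)
        have hun : (u.num.toNat : ℚ) = u * u.den := by
          rw [Rat.mul_den_eq_num]
          exact_mod_cast Int.toNat_of_nonneg (Rat.num_nonneg.2 hu)
        have hvn : (v.num.toNat : ℚ) = v * v.den := by
          rw [Rat.mul_den_eq_num]
          exact_mod_cast Int.toNat_of_nonneg (Rat.num_nonneg.2 hv.le)
        have hud : (0 : ℚ) < u.den := by exact_mod_cast u.den_pos
        have hvd : (0 : ℚ) < v.den := by exact_mod_cast v.den_pos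
        have hv0 : v.num.toNat * u.den ≠ 0 := by
          have : (0 : ℚ) < ((v.num.toNat * u.den : ℕ) : ℚ) := by
            push_cast; rw [hvn]; positivity
          intro h; rw [h] at this; simp at this
        refine ⟨(u.num.toNat * v.den) • s i.castSucc + (v.num.toNat * u.den) • s (Fin.last k),
          ?_, ?_⟩
        · rcases eq_or_ne (u.num.toNat * v.den) 0 with h | h
          · rw [h, zero_smul, zero_add]; exact hsmul _ hv0 _ (hs _)
          · exact hadd _ (hsmul _ h _ (hs _)) _ (hsmul _ hv0 _ (hs _))
        · intro χ hχ
          rw [map_add, map_nsmul, map_nsmul, nsmul_eq_mul, nsmul_eq_mul] at hχ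
          push_cast at hχ
          rw [hun, hvn] at hχ
          refine pos_of_mul_pos_left (b := (u.den : ℚ) * v.den) ?_ (by positivity)
          linarith
      choose b hbP hb using hex
      obtain ⟨χ, hχ⟩ := ih b hbP
      have hχ' := fun i => hb i χ (hχ i)
      have : Nonempty (Fin k) := ⟨⟨0, hk⟩⟩
      obtain ⟨j, hj⟩ := Finite.exists_max fun i : Fin k => -χ (s i.castSucc) / ψ (s i.castSucc)
      -- The sought map is `χ + t * ψ`. Positivity on the first `k` elements bounds `t` from below
      -- and on the last one from above; positivity of `χ` on each `b i` makes these bounds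
      -- compatible.
      obtain ⟨t, ht1, ht2⟩ : ∃ t : ℚ, -χ (s j.castSucc) / ψ (s j.castSucc) < t ∧
          0 < χ (s (Fin.last k)) + t * ψ (s (Fin.last k)) := by
        have hvj := hψ j
        rcases hneg.lt_or_eq with h | h
        · have h1 : -χ (s j.castSucc) / ψ (s j.castSucc) <
              χ (s (Fin.last k)) / (-ψ (s (Fin.last k))) := by
            rw [div_lt_div_iff₀ hvj (by linarith)]
            linarith [hχ' j]
          obtain ⟨t, h2, h3⟩ := exists_between h1
          refine ⟨t, h2, ?_⟩
          rw [lt_div_iff₀ (by linarith)] at h3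
          linarith
        · have h1 := hχ' j
          rw [h, neg_zero, zero_mul, zero_add] at h1
          refine ⟨_, lt_add_one _, ?_⟩
          rw [h, mul_zero, add_zero]
          exact pos_of_mul_pos_right h1 hvj.le
      refine ⟨χ + (AddMonoidHom.mulLeft t).comp ψ, fun i => ?_⟩
      refine Fin.lastCases (by simpa using ht2) (fun i => ?_) i
      have h1 := (hj i).trans_lt ht1
      rw [div_lt_iff₀ (hψ i)] at h1
      simp
      linarith

/-! ### Homomorphisms to the rationals and rational steps. -/

/-- A map which is additive on the subgroup `K`, and on `K` vanishes exactly on `H`. -/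
structure IsRatHom {G : Type*} [Group G] (H K : Subgroup G) (φ : G → ℚ) : Prop where
  le : H ≤ K
  map_mul : ∀ a ∈ K, ∀ b ∈ K, φ (a * b) = φ a + φ b
  eq_zero_iff : ∀ a ∈ K, φ a = 0 ↔ a ∈ H

section Quotient

variable {G : Type*} [Group G] {H K : Subgroup G}

theorem normal_subgroupOf_of_commutator (hc : ∀ a ∈ K, ∀ b ∈ K, a⁻¹ * b⁻¹ * a * b ∈ H) :
    (H.subgroupOf K).Normal := by
  refine ⟨fun n hn g => ?_⟩
  rw [Subgroup.mem_subgroupOf] at hn ⊢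
  have h1 := H.mul_mem hn (hc n n.2 (g⁻¹ : K) (g⁻¹ : K).2)
  simpa [mul_assoc] using h1

theorem quotient_mul_comm [(H.subgroupOf K).Normal] :
    (∀ a b : K ⧸ H.subgroupOf K, a * b = b * a) ↔
      ∀ a ∈ K, ∀ b ∈ K, a⁻¹ * b⁻¹ * a * b ∈ H := by
  have key : ∀ a b : K, ((a : K ⧸ H.subgroupOf K) * b = b * a) ↔
      ((b : G)⁻¹ * (a : G)⁻¹ * b * a ∈ H) := by
    intro a b
    rw [← QuotientGroup.mk_mul, ← QuotientGroup.mk_mul, QuotientGroup.eq,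
      Subgroup.mem_subgroupOf]
    simp [mul_assoc]
  constructor
  · intro h a ha b hb
    exact (key ⟨b, hb⟩ ⟨a, ha⟩).1 (h _ _)
  · intro h a b
    induction a using QuotientGroup.induction_on with | _ a
    induction b using QuotientGroup.induction_on with | _ b
    exact (key a b).2 (h _ b.2 _ a.2)

/-- Finitely many elements of `K` outside `H` contained in a multiplicatively closed subset
disjoint from `H` are positive for some homomorphism `K / H → ℚ`. -/
theorem exists_ratHom_pos (hHK : H ≤ K) (hc : ∀ a ∈ K, ∀ b ∈ K, a⁻¹ * b⁻¹ * a * b ∈ H) (P : Set G)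
    (hPK : P ⊆ K) (hPH : ∀ a ∈ P, a ∉ H) (hmul : ∀ a ∈ P, ∀ b ∈ P, a * b ∈ P)
    (S : Set G) (hS : S.Finite) (hSP : S ⊆ P) :
    ∃ φ : G → ℚ, (∀ a ∈ K, ∀ b ∈ K, φ (a * b) = φ a + φ b) ∧ (∀ a ∈ H, φ a = 0) ∧
      ∀ s ∈ S, 0 < φ s := by
  classical
  have hn := normal_subgroupOf_of_commutator hc
  let _ : CommGroup (K ⧸ H.subgroupOf K) :=
    { (inferInstance : Group (K ⧸ H.subgroupOf K)) with mul_comm := quotient_mul_comm.2 hc }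
  let π : K → Additive (K ⧸ H.subgroupOf K) := fun x => Additive.ofMul (x : K ⧸ H.subgroupOf K)
  have hπ : ∀ x y, π (x * y) = π x + π y := fun x y => rfl
  have hπeq : ∀ x y, π x = π y ↔ (x : G)⁻¹ * y ∈ H := by
    intro x y
    change ((x : K ⧸ H.subgroupOf K) = y) ↔ _
    rw [QuotientGroup.eq, Subgroup.mem_subgroupOf]; rfl
  have hπ0 : ∀ x, π x = 0 ↔ (x : G) ∈ H := by
    intro x
    have := hπeq 1 x
    rw [Subgroup.coe_one, inv_one, one_mul] at this
    rw [eq_comm]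
    exact this
  obtain ⟨n, s, hs⟩ := hS.fin_param
  have hsP : ∀ i, s i ∈ P := fun i => hSP (hs.2 ▸ ⟨i, rfl⟩)
  obtain ⟨ψ, hψ⟩ := exists_addMonoidHom_pos (π '' {x | (x : G) ∈ P}) (by
    rintro _ ⟨a, ha, rfl⟩ _ ⟨b, hb, rfl⟩
    exact ⟨a * b, hmul _ ha _ hb, hπ a b⟩) (by
    rintro ⟨a, ha, h0⟩
    exact hPH _ ha ((hπ0 a).1 h0)) n (fun i => π ⟨s i, hPK (hsP i)⟩) (fun i => ⟨_, hsP i, rfl⟩)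
  refine ⟨fun g => if h : g ∈ K then ψ (π ⟨g, h⟩) else 0, ?_, ?_, ?_⟩
  · intro a ha b hb
    simp only [ha, hb, mul_mem ha hb, dif_pos]
    rw [← map_add, ← hπ]; rfl
  · intro a ha
    simp only [hHK ha, dif_pos]
    rw [(hπ0 ⟨a, hHK ha⟩).2 ha, map_zero]
  · intro x hx
    rw [← hs.2] at hx
    obtain ⟨i, rfl⟩ := hx
    have h1 : s i ∈ K := hPK (hsP i)
    simp only [h1, dif_pos]
    exact hψ i

section Additive

variable {φ : G → ℚ} (h : ∀ a ∈ K, ∀ b ∈ K, φ (a * b) = φ a + φ b)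
include h

theorem map_one_of_map_mul : φ 1 = 0 := by
  have := h 1 (one_mem _) 1 (one_mem _)
  rw [mul_one] at this
  linarith

theorem map_inv_of_map_mul {a : G} (ha : a ∈ K) : φ a⁻¹ = -φ a := by
  have h1 := h a ha a⁻¹ (inv_mem ha)
  rw [mul_inv_cancel, map_one_of_map_mul h] at h1
  linarith

theorem map_pow_of_map_mul {a : G} (ha : a ∈ K) (n : ℕ) : φ (a ^ n) = n * φ a := by
  induction n with
  | zero => simpa using map_one_of_map_mul h
  | succ n ih => rw [pow_succ, h _ (pow_mem ha n) _ ha, ih]; push_cast; ring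

theorem map_zpow_of_map_mul {a : G} (ha : a ∈ K) (n : ℤ) : φ (a ^ n) = n * φ a := by
  obtain ⟨n, rfl | rfl⟩ := n.eq_nat_or_neg
  · simpa using map_pow_of_map_mul h ha n
  · rw [zpow_neg, map_inv_of_map_mul h (zpow_mem ha _), zpow_natCast, map_pow_of_map_mul h ha]
    push_cast; ring

end Additive

theorem IsRatHom.map_inv {φ : G → ℚ} (h : IsRatHom H K φ) {a : G} (ha : a ∈ K) :
    φ a⁻¹ = -φ a := map_inv_of_map_mul h.map_mul ha

theorem IsRatHom.map_pow {φ : G → ℚ} (h : IsRatHom H K φ) {a : G} (ha : a ∈ K) (n : ℕ) :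
    φ (a ^ n) = n * φ a := map_pow_of_map_mul h.map_mul ha n

theorem IsRatHom.map_zpow {φ : G → ℚ} (h : IsRatHom H K φ) {a : G} (ha : a ∈ K) (n : ℤ) :
    φ (a ^ n) = n * φ a := map_zpow_of_map_mul h.map_mul ha n

theorem IsRatHom.commutator_mem {φ : G → ℚ} (h : IsRatHom H K φ) {a b : G} (ha : a ∈ K)
    (hb : b ∈ K) : a⁻¹ * b⁻¹ * a * b ∈ H := by
  have ha' := inv_mem ha
  have hb' := inv_mem hb
  rw [← h.eq_zero_iff _ (mul_mem (mul_mem (mul_mem ha' hb') ha) hb),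
    h.map_mul _ (mul_mem (mul_mem ha' hb') ha) _ hb, h.map_mul _ (mul_mem ha' hb') _ ha,
    h.map_mul _ ha' _ hb', h.map_inv ha, h.map_inv hb]
  ring

end Quotient

theorem isTorsionFreeAbelianRankOne_iff {Q : Type*} [Group Q] :
    IsTorsionFreeAbelianRankOne Q ↔ Nontrivial Q ∧ (∀ a b : Q, a * b = b * a) ∧
      (∀ (a : Q) (n : ℕ), n ≠ 0 → a ^ n = 1 → a = 1) ∧
      ∀ a b : Q, ∃ m n : ℤ, (m ≠ 0 ∨ n ≠ 0) ∧ a ^ m * b ^ n = 1 := by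
  constructor
  · rintro ⟨htf, hc, hr⟩
    let _ : CommGroup Q := { (inferInstance : Group Q) with mul_comm := hc }
    have hr' : Module.rank ℤ (Additive Q) = 1 := hr
    refine ⟨?_, hc, ?_, ?_⟩
    · by_contra hn
      rw [not_nontrivial_iff_subsingleton] at hn
      have : Subsingleton (Additive Q) := hn
      rw [rank_subsingleton'] at hr'
      exact zero_ne_one hr'
    · intro a n hn ha
      exact htf.pow_left_injective hn (by simpa using ha)
    · intro a b
      by_contra hcon
      push Not at hcon
      have hli : LinearIndependent ℤ ![Additive.ofMul a, Additive.ofMul b] := by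
        rw [LinearIndependent.pair_iff]
        intro m n hmn
        by_contra h0
        exact hcon m n (by tauto) hmn
      have := hli.cardinal_lift_le_rank
      rw [hr'] at this
      simp at this
  · rintro ⟨hnt, hc, htf, hdep⟩
    let _ : CommGroup Q := { (inferInstance : Group Q) with mul_comm := hc }
    refine ⟨⟨fun n hn a b hab => ?_⟩, hc, ?_⟩
    · have h1 : (a * b⁻¹) ^ n = 1 := by
        rw [mul_pow, inv_pow]
        exact mul_inv_eq_one.2 hab
      exact mul_inv_eq_one.1 (htf _ n hn h1)
    · change Module.rank ℤ (Additive Q) = 1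
      apply le_antisymm
      · refine mod_cast rank_le (n := 1) fun s hs => ?_
        by_contra hcard
        obtain ⟨a, ha, b, hb, hab⟩ := Finset.one_lt_card.1 (not_le.1 hcard)
        obtain ⟨m, n, hmn, h1⟩ := hdep a.toMul b.toMul
        have h2 : m • a + n • b = 0 := h1
        have h3 : LinearIndependent ℤ ![a, b] := by
          have := hs.comp ![⟨a, ha⟩, ⟨b, hb⟩] (by
            intro i j
            fin_cases i <;> fin_cases j <;> simp [hab, hab.symm])
          convert this using 1
          funext i
          fin_cases i <;> rfl
        have := LinearIndependent.pair_iff.1 h3 m n h2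
        tauto
      · rw [Cardinal.one_le_iff_ne_zero, Ne, rank_eq_zero_iff]
        intro h0
        obtain ⟨a, ha⟩ := exists_ne (1 : Q)
        obtain ⟨n, hn, hna⟩ := h0 (Additive.ofMul a)
        exact ha (htf a n.natAbs (by simpa using hn) (by
          have h1 : a ^ n = 1 := hna
          rcases Int.natAbs_eq n with h | h <;> rw [h] at h1 <;> simpa using h1))

section Step

variable {G : Type*} [Group G] {H K : Subgroup G}

/-- Take `f` in `K` outside `H` and a homomorphism that kills `H` and is positive at `f`. If it
vanishes at `a`, a rank-one relation between `a` and `f` cannot involve `f`, so a power of `a` lies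
in `H`, and torsion-freeness puts `a` there. -/
theorem IsRationalStep.exists_isRatHom (h : IsRationalStep H K) :
    H < K ∧ ∃ φ, IsRatHom H K φ := by
  have hn := h.normal
  obtain ⟨hnt, hc, htf, hdep⟩ := isTorsionFreeAbelianRankOne_iff.1 h.quotient
  have hc' := quotient_mul_comm.1 hc
  have hq1 : ∀ x : K, (x : K ⧸ H.subgroupOf K) = 1 ↔ (x : G) ∈ H := fun x => by
    rw [QuotientGroup.eq_one_iff, Subgroup.mem_subgroupOf]
  obtain ⟨f, hf⟩ := exists_ne (1 : K ⧸ H.subgroupOf K)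
  induction f using QuotientGroup.induction_on with | _ f
  have hfH : (f : G) ∉ H := fun hfH => hf ((hq1 f).2 hfH)
  have hpow : ∀ n : ℕ, (f : G) ^ (n + 1) ∉ H := fun n hn => hf <| htf _ (n + 1) (by omega) <| by
    rw [← QuotientGroup.mk_pow, hq1]; exact hn
  obtain ⟨φ, hφ1, hφ2, hφ3⟩ := exists_ratHom_pos h.le hc' {x | ∃ n : ℕ, x = (f : G) ^ (n + 1)}
    (by rintro _ ⟨n, rfl⟩; exact pow_mem f.2 _) (by rintro _ ⟨n, rfl⟩; exact hpow n)
    (by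
      rintro _ ⟨n, rfl⟩ _ ⟨m, rfl⟩
      exact ⟨n + 1 + m, by rw [← pow_add]; congr 1⟩)
    {(f : G)} (Set.finite_singleton _) (by rintro _ rfl; exact ⟨0, by simp⟩)
  have hφf := hφ3 f rfl
  have key : ∀ a ∈ K, φ a = 0 → ∃ n : ℕ, n ≠ 0 ∧ a ^ n ∈ H := by
    intro a ha h0
    obtain ⟨m, n, hmn, h1⟩ := hdep (⟨a, ha⟩ : K) f
    rw [← QuotientGroup.mk_zpow, ← QuotientGroup.mk_zpow, ← QuotientGroup.mk_mul, hq1] at h1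
    have h1 : a ^ m * (f : G) ^ n ∈ H := h1
    have h2 := hφ2 _ h1
    rw [hφ1 _ (zpow_mem ha m) _ (zpow_mem f.2 n), map_zpow_of_map_mul hφ1 ha,
      map_zpow_of_map_mul hφ1 f.2, h0, mul_zero, zero_add] at h2
    have hn0 : n = 0 := by simpa [hφf.ne'] using h2
    subst hn0
    rw [zpow_zero, mul_one] at h1
    obtain ⟨k, rfl | rfl⟩ := m.eq_nat_or_neg
    · exact ⟨k, by simpa using hmn, by simpa using h1⟩
    · exact ⟨k, by simpa using hmn, by simpa using h1⟩
  refine ⟨lt_of_le_of_ne h.le (by rintro rfl; exact hfH f.2), φ, h.le, hφ1, fun a ha => ⟨?_, hφ2 a⟩⟩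
  intro h0
  obtain ⟨n, hn, han⟩ := key a ha h0
  rw [← hq1 ⟨a, ha⟩]
  refine htf _ n hn ?_
  rw [← QuotientGroup.mk_pow, hq1]; exact han

theorem IsRatHom.isRationalStep {φ : G → ℚ} (h : IsRatHom H K φ) (hne : H ≠ K) :
    IsRationalStep H K := by
  have hn : (H.subgroupOf K).Normal :=
    normal_subgroupOf_of_commutator fun a ha b hb => h.commutator_mem ha hb
  have hq1 : ∀ x : K, (x : K ⧸ H.subgroupOf K) = 1 ↔ φ x = 0 := fun x => by
    rw [QuotientGroup.eq_one_iff, Subgroup.mem_subgroupOf, h.eq_zero_iff _ x.2]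
  refine ⟨h.le, hn, isTorsionFreeAbelianRankOne_iff.2 ⟨?_, ?_, ?_, ?_⟩⟩
  · obtain ⟨x, hxK, hxH⟩ := Set.not_subset.1 fun hle => hne (le_antisymm h.le hle)
    refine ⟨(⟨x, hxK⟩ : K), 1, fun h1 => hxH ?_⟩
    rw [hq1, h.eq_zero_iff _ hxK] at h1
    exact h1
  · exact quotient_mul_comm.2 fun a ha b hb => h.commutator_mem ha hb
  · intro a n hn ha
    induction a using QuotientGroup.induction_on with | _ a
    rw [← QuotientGroup.mk_pow, hq1, Subgroup.coe_pow, h.map_pow a.2] at ha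
    rw [hq1]
    simpa [hn] using ha
  · intro a b
    induction a using QuotientGroup.induction_on with | _ a
    induction b using QuotientGroup.induction_on with | _ b
    have hzero : ∀ m n : ℤ, (a : K ⧸ H.subgroupOf K) ^ m * (b : K ⧸ H.subgroupOf K) ^ n = 1 ↔
        m * φ a + n * φ b = 0 := by
      intro m n
      rw [← QuotientGroup.mk_zpow, ← QuotientGroup.mk_zpow, ← QuotientGroup.mk_mul, hq1,
        Subgroup.coe_mul, h.map_mul _ (a ^ m).2 _ (b ^ n).2, Subgroup.coe_zpow, Subgroup.coe_zpow,
        h.map_zpow a.2, h.map_zpow b.2]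
    by_cases ha : φ a = 0
    · exact ⟨1, 0, by simp, (hzero _ _).2 (by simp [ha])⟩
    · refine ⟨(φ b).num * (φ a).den, -((φ a).num * (φ b).den), Or.inr ?_, (hzero _ _).2 ?_⟩
      · simp [ha]
      · have h1 := Rat.mul_den_eq_num (φ a)
        have h2 := Rat.mul_den_eq_num (φ b)
        push_cast
        rw [← h1, ← h2]
        ring

end Step

/-! ### Cones of conradian preorders on subgroups. -/

section Cone

variable {G : Type*} [Group G]

/-- `g` is strictly positive for the preorder whose nonnegative cone is `N`. -/
def IsPos (N : Set G) (g : G) : Prop := g ∈ N ∧ g⁻¹ ∉ N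

/-- `N` is the cone of nonnegative elements of a total left-invariant conradian preorder
(possibly the trivial one) on the subgroup `K`. -/
structure IsConradCone (K : Subgroup G) (N : Set G) : Prop where
  mem_iff : ∀ g, g ∈ K ↔ g ∈ N ∨ g⁻¹ ∈ N
  mul_closed : ∀ a b, a ∈ N → b ∈ N → a * b ∈ N
  conrad : ∀ a b, IsPos N a → IsPos N b → ∃ n : ℕ, IsPos N (a⁻¹ * b * a ^ n)

/-- The subgroup `M` is convex for the preorder with nonnegative cone `N`. -/
def IsConvexIn (N : Set G) (M : Subgroup G) : Prop :=
  ∀ x g, x ∈ N → x⁻¹ * g ∈ N → g ∈ M → x ∈ M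

theorem IsConvexIn.isPos_of_notMem {N : Set G} {M : Subgroup G} (hM : IsConvexIn N M) {a : G}
    (ha : a ∈ N) (haM : a ∉ M) : IsPos N a :=
  ⟨ha, fun h1 => haM (hM a 1 ha (by simpa using h1) (one_mem _))⟩

theorem isPos_inter_iff {N : Set G} {H : Subgroup G} {a : G} :
    IsPos (N ∩ H) a ↔ IsPos N a ∧ a ∈ H := by
  simp only [IsPos, Set.mem_inter_iff, SetLike.mem_coe, H.inv_mem_iff]
  tauto

/-- `E / D` is the jump of convex subgroups determined by the positive element `f`. -/
structure IsJump (K : Subgroup G) (N : Set G) (f : G) (D E : Subgroup G) : Prop where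
  le : D ≤ E
  le_top : E ≤ K
  convex_bot : IsConvexIn N D
  convex_top : IsConvexIn N E
  mem_top : f ∈ E
  notMem_bot : f ∉ D
  commutator_mem : ∀ a ∈ E, ∀ b ∈ E, a⁻¹ * b⁻¹ * a * b ∈ D
  top_le : ∀ M ≤ K, IsConvexIn N M → f ∈ M → E ≤ M
  mem_of_notMem_bot : ∀ M ≤ K, IsConvexIn N M → ∀ x ∈ M, x ∉ D → f ∈ M
  mem_bot : ∀ g ∈ K, (∀ n : ℤ, IsPos N ((g ^ n)⁻¹ * f)) → g ∈ D

namespace IsConradCone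

variable {K : Subgroup G} {N : Set G} (h : IsConradCone K N)
include h

theorem one_mem_cone : (1 : G) ∈ N := by
  simpa using (h.mem_iff 1).1 K.one_mem

theorem subset : N ⊆ K := fun g hg => (h.mem_iff g).2 (Or.inl hg)

theorem mem_or_inv_mem {g : G} (hg : g ∈ K) : g ∈ N ∨ g⁻¹ ∈ N := (h.mem_iff g).1 hg

theorem pow_mem_cone {g : G} (hg : g ∈ N) (n : ℕ) : g ^ n ∈ N := by
  induction n with
  | zero => simpa using h.one_mem_cone
  | succ n ih => rw [pow_succ]; exact h.mul_closed _ _ ih hg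

theorem isPos_of_inv_notMem {g : G} (hg : g ∈ K) (hg' : g⁻¹ ∉ N) : IsPos N g :=
  ⟨(h.mem_or_inv_mem hg).resolve_right hg', hg'⟩

theorem isPos_mul_right {M : Subgroup G} (hMK : M ≤ K) (hM : IsConvexIn N M) {a d : G}
    (ha : a ∈ N) (haM : a ∉ M) (hd : d ∈ M) : IsPos N (a * d) := by
  refine h.isPos_of_inv_notMem (mul_mem (h.subset ha) (hMK hd)) fun h1 => haM ?_
  have h2 := hM _ d⁻¹ h1 (by simpa using ha) (inv_mem hd)
  exact (M.mul_mem_cancel_right hd).1 (M.inv_mem_iff.1 h2)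

theorem isPos_mul_left {M : Subgroup G} (hMK : M ≤ K) (hM : IsConvexIn N M) {a d : G}
    (ha : a ∈ N) (haM : a ∉ M) (hd : d ∈ M) : IsPos N (d * a) := by
  refine h.isPos_of_inv_notMem (mul_mem (hMK hd) (h.subset ha)) fun h1 => haM ?_
  exact hM a d⁻¹ ha (by simpa using h1) (inv_mem hd)

theorem mem_of_pow_mem {M : Subgroup G} (hM : IsConvexIn N M) {g : G} (hg : g ∈ K) {m : ℕ}
    (hm : m ≠ 0) (hgm : g ^ m ∈ M) : g ∈ M := by
  obtain ⟨m, rfl⟩ := Nat.exists_eq_succ_of_ne_zero hm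
  rcases h.mem_or_inv_mem hg with h1 | h1
  · exact hM g _ h1 (by rw [Nat.succ_eq_add_one, pow_succ', inv_mul_cancel_left]
                        exact h.pow_mem_cone h1 m) hgm
  · rw [← M.inv_mem_iff]
    refine hM g⁻¹ ((g⁻¹) ^ (m + 1)) h1 ?_ (by rw [inv_pow]; exact inv_mem hgm)
    rw [pow_succ', inv_mul_cancel_left]
    exact h.pow_mem_cone h1 m

theorem inter {H : Subgroup G} (hH : H ≤ K) : IsConradCone H (N ∩ H) := by
  refine ⟨fun g => ?_, fun a b ha hb => ⟨h.mul_closed _ _ ha.1 hb.1, mul_mem ha.2 hb.2⟩,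
    fun a b ha hb => ?_⟩
  · have := fun hg : g ∈ H => h.mem_or_inv_mem (hH hg)
    simp only [Set.mem_inter_iff, SetLike.mem_coe, H.inv_mem_iff]
    tauto
  · rw [isPos_inter_iff] at ha hb
    obtain ⟨n, hn⟩ := h.conrad a b ha.1 hb.1
    exact ⟨n, isPos_inter_iff.2 ⟨hn, mul_mem (mul_mem (inv_mem ha.2) hb.2)
      (pow_mem ha.2 n)⟩⟩

/-- The preorder on `K` with nonnegative cone `N`. -/
@[reducible]
def toPreorder : Preorder K where
  le a b := ((a⁻¹ * b : K) : G) ∈ N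
  le_refl a := by simpa using h.one_mem_cone
  le_trans a b c hab hbc := by
    have := h.mul_closed _ _ hab hbc
    have h2 : (((a⁻¹ * b : K) : G)) * ((b⁻¹ * c : K) : G) = ((a⁻¹ * c : K) : G) := by
      rw [← Subgroup.coe_mul]; congr 1; group
    rwa [h2] at this

theorem toPreorder_lt_iff {a b : K} : h.toPreorder.lt a b ↔ IsPos N ((a⁻¹ * b : K) : G) := by
  have h1 : ((b⁻¹ * a : K) : G) = ((a⁻¹ * b : K) : G)⁻¹ := by simp
  change ((a⁻¹ * b : K) : G) ∈ N ∧ ¬ ((b⁻¹ * a : K) : G) ∈ N ↔ _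
  rw [h1]; rfl

theorem isConradPreorder : @IsConradPreorder K _ h.toPreorder := by
  refine @IsConradPreorder.mk K _ h.toPreorder ?_ ?_ ?_
  · intro c a b hab
    change (((c * a)⁻¹ * (c * b) : K) : G) ∈ N
    have h1 : (c * a)⁻¹ * (c * b) = a⁻¹ * b := by group
    rw [h1]; exact hab
  · intro a b
    have h1 : ((b⁻¹ * a : K) : G) = ((a⁻¹ * b : K) : G)⁻¹ := by simp
    change ((a⁻¹ * b : K) : G) ∈ N ∨ ((b⁻¹ * a : K) : G) ∈ N
    rw [h1]; exact h.mem_or_inv_mem (a⁻¹ * b : K).2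
  · intro a b ha hb
    obtain ⟨n, hn⟩ := h.conrad a b (by simpa using h.toPreorder_lt_iff.1 ha)
      (by simpa using h.toPreorder_lt_iff.1 hb)
    exact ⟨n, h.toPreorder_lt_iff.2 (by simpa [mul_assoc] using hn)⟩

theorem exists_isJump {f : G} (hf : IsPos N f) : ∃ D E : Subgroup G, IsJump K N f D E := by
  have hfK : f ∈ K := h.subset hf.1
  let _ := h.toPreorder
  have hc : IsConradPreorder K := h.isConradPreorder
  have hf1 : 1 < (⟨f, hfK⟩ : K) := h.toPreorder_lt_iff.2 (by simpa using hf)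
  have hle : ∀ a b : K, a ≤ b ↔ ((a : G)⁻¹ * b) ∈ N := fun a b => Iff.rfl
  have hconv : ∀ M : Subgroup K, IsConradPreorder.IsConvex M → IsConvexIn N (M.map K.subtype) := by
    rintro M hM x _ hx hxg ⟨g, hg, rfl⟩
    exact ⟨⟨x, h.subset hx⟩, hM _ g ((hle _ _).2 (by simpa using hx)) ((hle _ _).2 hxg) hg, rfl⟩
  have hconv' : ∀ M ≤ K, IsConvexIn N M → IsConradPreorder.IsConvex (M.subgroupOf K) := by
    intro M hMK hM x g hx hxg hg
    exact hM x g (by simpa using (hle _ _).1 hx) ((hle _ _).1 hxg) hg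
  refine ⟨(hc.core hf1).map K.subtype, (hc.hull hf1).map K.subtype,
    Subgroup.map_mono (hc.core_le_hull hf1), ?_, hconv _ (hc.isConvex_core hf1),
    hconv _ (hc.isConvex_hull hf1), ⟨_, hc.self_mem_hull hf1, rfl⟩, ?_, ?_, ?_, ?_, ?_⟩
  · rintro _ ⟨x, -, rfl⟩; exact x.2
  · rintro ⟨x, hx, hxf⟩
    have : x = ⟨f, hfK⟩ := Subtype.ext hxf
    exact hc.self_notMem_core hf1 (this ▸ hx)
  · rintro _ ⟨a, ha, rfl⟩ _ ⟨b, hb, rfl⟩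
    exact ⟨_, hc.commutator_mem_core hf1 ha hb, rfl⟩
  · rintro M hMK hM hfM _ ⟨x, hx, rfl⟩
    exact hc.hull_le hf1 (hconv' M hMK hM) hfM hx
  · intro M hMK hM x hxM hx
    have hx' : (⟨x, hMK hxM⟩ : K) ∉ hc.core hf1 := fun h1 => hx ⟨_, h1, rfl⟩
    exact hc.mem_of_notMem_core hf1 hx' (hconv' M hMK hM) hxM
  · intro g hg hgf
    exact ⟨⟨g, hg⟩, fun n => h.toPreorder_lt_iff.2 (by simpa using hgf n), rfl⟩

end IsConradCone

end Cone

/-! ### Convexity in series without abelian jumps, and lexicographic extension. -/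

section Rigid

variable {G : Type*} [Group G] {K : Subgroup G} {N : Set G}

/-- The subgroup of elements equivalent to `1`. -/
def IsConradCone.residue (h : IsConradCone K N) : Subgroup G where
  carrier := {g | g ∈ N ∧ g⁻¹ ∈ N}
  one_mem' := by simpa using h.one_mem_cone
  mul_mem' := by
    rintro a b ⟨ha, ha'⟩ ⟨hb, hb'⟩
    exact ⟨h.mul_closed _ _ ha hb, by rw [mul_inv_rev]; exact h.mul_closed _ _ hb' ha'⟩
  inv_mem' := by rintro a ⟨ha, ha'⟩; exact ⟨ha', by simpa using ha⟩

theorem IsConradCone.isConvexIn_residue (h : IsConradCone K N) : IsConvexIn N h.residue := by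
  rintro x g hx hxg ⟨-, hg⟩
  exact ⟨hx, by simpa using h.mul_closed _ _ hxg hg⟩

theorem IsRatHom.exists_pow_mem {A B : Subgroup G} {φ : G → ℚ} (hφ : IsRatHom A B φ) {g x : G}
    (hg : g ∈ B) (hgA : g ∉ A) (hx : x ∈ B) :
    ∃ (m : ℕ) (k : ℤ), m ≠ 0 ∧ (g ^ k)⁻¹ * x ^ m ∈ A := by
  have hg0 : φ g ≠ 0 := fun h0 => hgA ((hφ.eq_zero_iff g hg).1 h0)
  refine ⟨(φ x / φ g).den, (φ x / φ g).num, (φ x / φ g).den_nz, ?_⟩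
  rw [← hφ.eq_zero_iff _ (mul_mem (inv_mem (zpow_mem hg _)) (pow_mem hx _)),
    hφ.map_mul _ (inv_mem (zpow_mem hg _)) _ (pow_mem hx _), hφ.map_inv (zpow_mem hg _),
    hφ.map_zpow hg, hφ.map_pow hx, ← Rat.mul_den_eq_num]
  field_simp
  ring

/-- Convex subgroups are closed under roots, and in a rank-one quotient every element has a nonzero
power that agrees with a power of `g` modulo `A`. -/
theorem IsConradCone.le_of_mem (h : IsConradCone K N) {A B M : Subgroup G} {φ : G → ℚ}
    (hφ : IsRatHom A B φ) (hBK : B ≤ K) (hM : IsConvexIn N M) (hAM : A ≤ M) {g : G} (hg : g ∈ B)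
    (hgA : g ∉ A) (hgM : g ∈ M) : B ≤ M := by
  intro x hx
  obtain ⟨m, k, hm, hmem⟩ := hφ.exists_pow_mem hg hgA hx
  exact h.mem_of_pow_mem hM (hBK hx) hm
    ((M.mul_mem_cancel_left (inv_mem (zpow_mem hgM k))).1 (hAM hmem))

/-- A rational series, given as a sequence of subgroups, without abelian jumps. -/
structure IsRigidSeries (F : ℕ → Subgroup G) (n : ℕ) : Prop where
  bot : F 0 = ⊥
  lt : ∀ i < n, F i < F (i + 1)
  step : ∀ i < n, ∃ φ, IsRatHom (F i) (F (i + 1)) φ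
  no_jump : ∀ i, i + 2 ≤ n →
    ¬ ∀ a ∈ F (i + 2), ∀ b ∈ F (i + 2), a⁻¹ * b⁻¹ * a * b ∈ F i

/-- The penultimate term of a rational series without abelian jumps is convex for every
nontrivial conradian preorder. -/
theorem IsRigidSeries.isConvexIn {F : ℕ → Subgroup G} {n : ℕ} (hF : IsRigidSeries F n) :
    ∀ i < n, ∀ N, IsConradCone (F (i + 1)) N → N ≠ F (i + 1) → IsConvexIn N (F i) := by
  intro i
  induction i with
  | zero =>
    intro hi N h hN x g hx hxg hg
    rw [hF.bot, Subgroup.mem_bot] at hg ⊢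
    subst hg
    by_contra hx1
    obtain ⟨φ, hφ⟩ := hF.step 0 hi
    refine hN (subset_antisymm h.subset fun y hy => ?_)
    exact (h.le_of_mem hφ le_rfl h.isConvexIn_residue (by rw [hF.bot]; exact bot_le) (h.subset hx)
      (by rw [hF.bot]; exact hx1) ⟨hx, by simpa using hxg⟩ hy).1
  | succ j ih =>
    intro hi N h hN
    obtain ⟨φ, hφ⟩ := hF.step _ hi
    obtain ⟨ψ, hψ⟩ := hF.step j (by omega)
    by_cases hHN : (F (j + 1) : Set G) ⊆ N
    -- The restriction to `F (j + 1)` is trivial: the residue is then exactly `F (j + 1)`, since by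
    -- rank one a larger residue would be everything.
    · have hle : F (j + 1) ≤ h.residue := fun x hx => ⟨hHN hx, hHN (inv_mem hx)⟩
      have : h.residue = F (j + 1) := by
        refine le_antisymm (fun x hx => ?_) hle
        by_contra hxH
        refine hN (subset_antisymm h.subset fun y hy => ?_)
        exact (h.le_of_mem hφ le_rfl h.isConvexIn_residue hle (h.subset hx.1) hxH hx hy).1
      rw [← this]
      exact h.isConvexIn_residue
    · have hres := h.inter hφ.le
      have hL := ih (by omega) _ hres fun heq => hHN (Set.inter_eq_right.1 heq)
      obtain ⟨f, hfH, hfL, hfN⟩ : ∃ f ∈ F (j + 1), f ∉ F j ∧ f ∈ N := by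
        obtain ⟨f, hfH, hfL⟩ := SetLike.exists_of_lt (hF.lt j (by omega))
        rcases h.mem_or_inv_mem (hφ.le hfH) with h1 | h1
        · exact ⟨f, hfH, hfL, h1⟩
        · exact ⟨f⁻¹, inv_mem hfH, by simpa using hfL, h1⟩
      have hfpos := (isPos_inter_iff.1 (hL.isPos_of_notMem ⟨hfN, hfH⟩ hfL)).1
      -- By rank one, `D` meets `F (j + 1)` exactly in `F j`, while `E` contains `F (j + 1)`. A
      -- failure of convexity would put all of `F (j + 2)` into `E`, so its commutators would lie in
      -- `D` and in `F (j + 1)`, hence in `F j`: an abelian jump.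
      obtain ⟨D, E, hJ⟩ := h.exists_isJump hfpos
      have hLD : F j ≤ D := fun g hg => hJ.mem_bot g (hφ.le (hψ.le hg)) fun n =>
        (isPos_inter_iff.1 (hres.isPos_mul_left hψ.le hL ⟨hfN, hfH⟩ hfL
          (inv_mem (zpow_mem hg n)))).1
      have hDL : ∀ x ∈ D, x ∈ F (j + 1) → x ∈ F j := by
        intro x hxD hxH
        by_contra hxL
        exact hJ.notMem_bot (h.le_of_mem hψ hφ.le hJ.convex_bot hLD hxH hxL hxD hfH)
      have hHE := h.le_of_mem hψ hφ.le hJ.convex_top (hLD.trans hJ.le) hfH hfL hJ.mem_top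
      intro x g hx hxg hg
      by_contra hxH
      have hKE := h.le_of_mem hφ le_rfl hJ.convex_top hHE (h.subset hx) hxH
        (hJ.convex_top x g hx hxg (hHE hg))
      exact hF.no_jump j (by omega) fun a ha b hb =>
        hDL _ (hJ.commutator_mem a (hKE ha) b (hKE hb)) (hφ.commutator_mem ha hb)

/-- The extension of a cone `M` on the kernel of `φ` to the domain `K` of `φ`. -/
def extendCone (K : Subgroup G) (φ : G → ℚ) (M : Set G) : Set G := {g | g ∈ K ∧ 0 < φ g} ∪ M

theorem IsRatHom.neg {H : Subgroup G} {φ : G → ℚ} (hφ : IsRatHom H K φ) :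
    IsRatHom H K (-φ) where
  le := hφ.le
  map_mul a ha b hb := by simp only [Pi.neg_apply, hφ.map_mul a ha b hb]; ring
  eq_zero_iff a ha := by simpa using hφ.eq_zero_iff a ha

section Extend

variable {H : Subgroup G} {φ : G → ℚ} (hφ : IsRatHom H K φ) {M : Set G}
include hφ

theorem IsRatHom.extendCone_inter (hM : M ⊆ H) : extendCone K φ M ∩ H = M := by
  ext g
  constructor
  · rintro ⟨⟨hg, h0⟩ | hg, hgH⟩
    · rw [(hφ.eq_zero_iff g hg).2 hgH] at h0
      exact absurd h0 (lt_irrefl _)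
    · exact hg
  · exact fun hg => ⟨Or.inr hg, hM hg⟩

theorem IsRatHom.isPos_extendCone (hM : M ⊆ H) {g : G} (hg : g ∈ K) :
    IsPos (extendCone K φ M) g ↔ 0 < φ g ∨ IsPos M g := by
  have hz : ∀ x ∈ M, φ x = 0 := fun x hx => (hφ.eq_zero_iff x (hφ.le (hM hx))).2 (hM hx)
  have h1 : g ∈ M → φ g = 0 := hz g
  have h2 : g⁻¹ ∈ M → φ g = 0 := fun h => by
    have := hz _ h
    rw [hφ.map_inv hg] at this; linarith
  simp only [IsPos, extendCone, Set.mem_union, Set.mem_ofPred_eq, hg, inv_mem hg, true_and,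
    hφ.map_inv hg]
  constructor
  · rintro ⟨h3 | h3, h4⟩
    · exact Or.inl h3
    · exact Or.inr ⟨h3, fun h5 => h4 (Or.inr h5)⟩
  · rintro (h3 | ⟨h3, h4⟩)
    · refine ⟨Or.inl h3, ?_⟩
      rintro (h4 | h4)
      · linarith
      · linarith [h2 h4]
    · refine ⟨Or.inr h3, ?_⟩
      rintro (h5 | h5)
      · linarith [h1 h3]
      · exact h4 h5

theorem IsRatHom.isConradCone_extendCone (hM : IsConradCone H M) :
    IsConradCone K (extendCone K φ M) := by
  have hz : ∀ x ∈ H, φ x = 0 := fun x hx => (hφ.eq_zero_iff x (hφ.le hx)).2 hx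
  have hsub : extendCone K φ M ⊆ K := by
    rintro g (hg | hg)
    exacts [hg.1, hφ.le (hM.subset hg)]
  have hnn : ∀ g ∈ extendCone K φ M, 0 ≤ φ g := by
    rintro g (hg | hg)
    exacts [hg.2.le, (hz g (hM.subset hg)).ge]
  refine ⟨fun g => ⟨fun hg => ?_, ?_⟩, ?_, ?_⟩
  · rcases lt_trichotomy (φ g) 0 with h0 | h0 | h0
    · exact Or.inr (Or.inl ⟨inv_mem hg, by rw [hφ.map_inv hg]; linarith⟩)
    · exact (hM.mem_or_inv_mem ((hφ.eq_zero_iff g hg).1 h0)).imp Or.inr Or.inr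
    · exact Or.inl (Or.inl ⟨hg, h0⟩)
  · rintro (hg | hg)
    · exact hsub hg
    · simpa using hsub hg
  · intro a b ha hb
    have hab := hφ.map_mul a (hsub ha) b (hsub hb)
    have h1 := hnn a ha
    have h2 := hnn b hb
    rcases ha with ha | ha
    · exact Or.inl ⟨mul_mem ha.1 (hsub hb), by linarith [ha.2]⟩
    · rcases hb with hb | hb
      · exact Or.inl ⟨mul_mem (hφ.le (hM.subset ha)) hb.1, by linarith [hb.2]⟩
      · exact Or.inr (hM.mul_closed _ _ ha hb)
  · intro a b ha hb
    have haK := hsub ha.1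
    have hbK := hsub hb.1
    have h2 := hnn b hb.1
    have hconj : ∀ n : ℕ, a⁻¹ * b * a ^ n ∈ K := fun n =>
      mul_mem (mul_mem (inv_mem haK) hbK) (pow_mem haK n)
    have hval : ∀ n : ℕ, φ (a⁻¹ * b * a ^ n) = -φ a + φ b + n * φ a := fun n => by
      rw [hφ.map_mul _ (mul_mem (inv_mem haK) hbK) _ (pow_mem haK n),
        hφ.map_mul _ (inv_mem haK) _ hbK, hφ.map_inv haK, hφ.map_pow haK]
    have hMH := hM.subset
    rcases (hφ.isPos_extendCone hMH haK).1 ha with h3 | h3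
    -- With exponent `2` the value of `φ` is `φ a + φ b`, which is positive.
    · refine ⟨2, (hφ.isPos_extendCone hMH (hconj 2)).2 (Or.inl ?_)⟩
      rw [hval]; push_cast; linarith
    · have ha0 := hz a (hMH h3.1)
      rcases (hφ.isPos_extendCone hMH hbK).1 hb with h4 | h4
      · refine ⟨0, (hφ.isPos_extendCone hMH (hconj 0)).2 (Or.inl ?_)⟩
        rw [hval, ha0]; simpa using h4
      · obtain ⟨n, hn⟩ := hM.conrad a b h3 h4
        exact ⟨n, (hφ.isPos_extendCone hMH (hconj n)).2 (Or.inr hn)⟩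

theorem IsRatHom.eq_extendCone_of_pos {N : Set G} (h : IsConradCone K N) (hH : IsConvexIn N H)
    {f : G} (hf : f ∈ N) (hfpos : 0 < φ f) : N = extendCone K φ (N ∩ H) := by
  have hfK := h.subset hf
  have hpos : ∀ g ∈ K, 0 < φ g → IsPos N g := by
    intro g hg hg0
    refine h.isPos_of_inv_notMem hg fun hgi => ?_
    -- Write `φ g / φ f = k / m`. Then `g ^ m` equals `f ^ k` up to a left factor in `H`, hence is
    -- positive by convexity of `H`, so `g⁻¹` cannot lie in `N`.
    have hq : 0 < φ g / φ f := div_pos hg0 hfpos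
    obtain ⟨k, hk⟩ := Int.eq_ofNat_of_zero_le (Rat.num_nonneg.2 hq.le)
    set m := (φ g / φ f).den
    have hm : (φ g / φ f) * m = k := by rw [Rat.mul_den_eq_num, hk]; simp
    have hm' : (m : ℚ) * φ g = k * φ f := by
      rw [← hm]; field_simp
    have hk0 : k ≠ 0 := by
      rintro rfl
      have : (0 : ℚ) < m := by exact_mod_cast (φ g / φ f).den_pos
      rw [Nat.cast_zero, mul_eq_zero] at hm
      rcases hm with hm | hm
      exacts [hq.ne' hm, this.ne' hm]
    have hmem : g ^ m * (f ^ k)⁻¹ ∈ H := by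
      rw [← hφ.eq_zero_iff _ (mul_mem (pow_mem hg _) (inv_mem (pow_mem hfK _))),
        hφ.map_mul _ (pow_mem hg _) _ (inv_mem (pow_mem hfK _)), hφ.map_pow hg,
        hφ.map_inv (pow_mem hfK _), hφ.map_pow hfK, hm']
      ring
    have hfk : f ^ k ∉ H := by
      rw [← hφ.eq_zero_iff _ (pow_mem hfK _), hφ.map_pow hfK]
      have : (k : ℚ) ≠ 0 := by exact_mod_cast hk0
      exact mul_ne_zero this hfpos.ne'
    have hp := h.isPos_mul_left hφ.le hH (h.pow_mem_cone hf k) hfk hmem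
    rw [inv_mul_cancel_right] at hp
    exact hp.2 (by rw [← inv_pow]; exact h.pow_mem_cone hgi m)
  ext g
  constructor
  · intro hg
    have hgK := h.subset hg
    rcases lt_trichotomy (φ g) 0 with h0 | h0 | h0
    · have := hpos g⁻¹ (inv_mem hgK) (by rw [hφ.map_inv hgK]; linarith)
      exact absurd (by simpa using hg) this.2
    · exact Or.inr ⟨hg, (hφ.eq_zero_iff g hgK).1 h0⟩
    · exact Or.inl ⟨hgK, h0⟩
  · rintro (⟨hg, h0⟩ | hg)
    · exact (hpos g hg h0).1
    · exact hg.1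

theorem IsRatHom.eq_extendCone (hne : H < K) {N : Set G} (h : IsConradCone K N)
    (hH : IsConvexIn N H) :
    N = extendCone K φ (N ∩ H) ∨ N = extendCone K (-φ) (N ∩ H) := by
  obtain ⟨f, hfK, hfH, hfN⟩ : ∃ f ∈ K, f ∉ H ∧ f ∈ N := by
    obtain ⟨f, hfK, hfH⟩ := SetLike.exists_of_lt hne
    rcases h.mem_or_inv_mem hfK with h1 | h1
    · exact ⟨f, hfK, hfH, h1⟩
    · exact ⟨f⁻¹, inv_mem hfK, by simpa using hfH, h1⟩
  have h0 : φ f ≠ 0 := fun h0 => hfH ((hφ.eq_zero_iff f hfK).1 h0)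
  rcases h0.lt_or_gt with h0 | h0
  · exact Or.inr (hφ.neg.eq_extendCone_of_pos h hH hfN (by simpa using h0))
  · exact Or.inl (hφ.eq_extendCone_of_pos h hH hfN h0)

end Extend

end Rigid

/-! ### Counting cones along a rational series. -/

section Count

variable {G : Type*} [Group G]

/-- The cones of the conradian preorders on `K`, including the trivial one. -/
def conradCones (K : Subgroup G) : Set (Set G) := {N | IsConradCone K N}

/-- The cones of the conradian left-orders on `K`. -/
def conradOrderCones (K : Subgroup G) : Set (Set G) :=
  {N | IsConradCone K N ∧ ∀ g ∈ N, g⁻¹ ∈ N → g = 1}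

theorem isConradCone_self (K : Subgroup G) : IsConradCone K (K : Set G) where
  mem_iff g := by simp
  mul_closed _ _ ha hb := mul_mem ha hb
  conrad _ _ ha := absurd (inv_mem ha.1) ha.2

section Extend

variable {H K : Subgroup G} {φ : G → ℚ} (hφ : IsRatHom H K φ) (hne : H < K)
include hφ hne

theorem IsRatHom.exists_pos : ∃ g ∈ K, 0 < φ g := by
  obtain ⟨f, hfK, hfH⟩ := SetLike.exists_of_lt hne
  have h0 : φ f ≠ 0 := fun h0 => hfH ((hφ.eq_zero_iff f hfK).1 h0)
  rcases h0.lt_or_gt with h0 | h0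
  · exact ⟨f⁻¹, inv_mem hfK, by rw [hφ.map_inv hfK]; linarith⟩
  · exact ⟨f, hfK, h0⟩

theorem IsRatHom.extendCone_ne {M : Set G} (hM : M ⊆ H) : extendCone K φ M ≠ K := by
  obtain ⟨g, hgK, hg⟩ := hφ.exists_pos hne
  intro heq
  have h1 := ((hφ.isPos_extendCone hM hgK).2 (Or.inl hg)).2
  rw [heq] at h1
  exact h1 (inv_mem hgK)

theorem IsRatHom.extendCone_ne_neg {M M' : Set G} (hM : M ⊆ H) (hM' : M' ⊆ H) :
    extendCone K φ M ≠ extendCone K (-φ) M' := by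
  obtain ⟨g, hgK, hg⟩ := hφ.exists_pos hne
  intro heq
  have h1 := ((hφ.isPos_extendCone hM hgK).2 (Or.inl hg)).2
  have h2 := ((hφ.neg.isPos_extendCone hM' (inv_mem hgK)).2
    (Or.inl (by simpa [hφ.map_inv hgK] using hg))).1
  rw [heq] at h1
  exact h1 h2

omit hne in
theorem IsRatHom.injOn_extendCone {s : Set (Set G)} (hs : ∀ M ∈ s, M ⊆ H) :
    Set.InjOn (extendCone K φ) s := by
  intro M hM M' hM' heq
  rw [← hφ.extendCone_inter (hs M hM), ← hφ.extendCone_inter (hs M' hM'), heq]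

theorem IsRatHom.encard_images {s : Set (Set G)} (hs : ∀ M ∈ s, M ⊆ H) :
    (extendCone K φ '' s ∪ extendCone K (-φ) '' s).encard = 2 * s.encard := by
  rw [Set.encard_union_eq, (hφ.injOn_extendCone hs).encard_image,
    (hφ.neg.injOn_extendCone hs).encard_image, two_mul]
  rw [Set.disjoint_left]
  rintro _ ⟨M, hM, rfl⟩ ⟨M', hM', heq⟩
  exact hφ.extendCone_ne_neg hne (hs M hM) (hs M' hM') heq.symm

variable (hconv : ∀ N, IsConradCone K N → N ≠ K → IsConvexIn N H)
include hconv

theorem IsRatHom.conradCones_eq : conradCones K =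
    insert (K : Set G) (extendCone K φ '' conradCones H ∪ extendCone K (-φ) '' conradCones H) := by
  ext N
  constructor
  · intro hN
    have hN : IsConradCone K N := hN
    by_cases hNK : N = K
    · exact Or.inl hNK
    · refine Or.inr ?_
      have hI : N ∩ H ∈ conradCones H := hN.inter hφ.le
      rcases hφ.eq_extendCone hne hN (hconv N hN hNK) with h1 | h1
      · exact Or.inl ⟨_, hI, h1.symm⟩
      · exact Or.inr ⟨_, hI, h1.symm⟩
  · rintro (rfl | ⟨M, hM, rfl⟩ | ⟨M, hM, rfl⟩)
    · exact isConradCone_self K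
    · exact hφ.isConradCone_extendCone hM
    · exact hφ.neg.isConradCone_extendCone hM

theorem IsRatHom.encard_conradCones :
    (conradCones K).encard = 2 * (conradCones H).encard + 1 := by
  rw [hφ.conradCones_eq hne hconv, Set.encard_insert_of_notMem,
    hφ.encard_images hne fun M hM => hM.subset]
  rintro (⟨M, hM, heq⟩ | ⟨M, hM, heq⟩)
  · exact hφ.extendCone_ne hne hM.subset heq
  · exact hφ.neg.extendCone_ne hne hM.subset heq

omit hne hconv in
theorem IsRatHom.extendCone_mem_conradOrderCones {M : Set G} (hM : M ∈ conradOrderCones H) :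
    extendCone K φ M ∈ conradOrderCones K := by
  have hc := hφ.isConradCone_extendCone hM.1
  refine ⟨hc, fun g hg hgi => ?_⟩
  have hgK := hc.subset hg
  have h1 := mt (hφ.isPos_extendCone hM.1.subset hgK).2 fun h => h.2 hgi
  push Not at h1
  rcases hg with hg | hg
  · exact absurd hg.2 (not_lt.2 h1.1)
  · have : g⁻¹ ∈ M := by
      by_contra h2
      exact h1.2 ⟨hg, h2⟩
    exact hM.2 g hg this

theorem IsRatHom.conradOrderCones_eq : conradOrderCones K =
    extendCone K φ '' conradOrderCones H ∪ extendCone K (-φ) '' conradOrderCones H := by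
  ext N
  constructor
  · rintro ⟨hN, hN1⟩
    have hNK : N ≠ K := by
      rintro rfl
      obtain ⟨f, hfK, hfH⟩ := SetLike.exists_of_lt hne
      exact hfH (hN1 f hfK (inv_mem hfK) ▸ one_mem H)
    have hI : N ∩ H ∈ conradOrderCones H :=
      ⟨hN.inter hφ.le, fun g hg hgi => hN1 g hg.1 hgi.1⟩
    rcases hφ.eq_extendCone hne hN (hconv N hN hNK) with h1 | h1
    · exact Or.inl ⟨_, hI, h1.symm⟩
    · exact Or.inr ⟨_, hI, h1.symm⟩
  · rintro (⟨M, hM, rfl⟩ | ⟨M, hM, rfl⟩)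
    · exact hφ.extendCone_mem_conradOrderCones hM
    · exact hφ.neg.extendCone_mem_conradOrderCones hM

theorem IsRatHom.encard_conradOrderCones :
    (conradOrderCones K).encard = 2 * (conradOrderCones H).encard := by
  rw [hφ.conradOrderCones_eq hne hconv, hφ.encard_images hne fun M hM => hM.1.subset]

/-- A proper rational step below `K` coincides with a subgroup that is convex for every
nontrivial conradian preorder on `K`. -/
theorem IsRatHom.eq_of_isConvexIn {H' : Subgroup G} {φ' : G → ℚ} (hφ' : IsRatHom H' K φ')
    (hne' : H' < K) : H' = H := by
  -- The trivial cone on `H'` extended along `φ'` is a nontrivial preorder in which `H'` is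
  -- equivalent to `1`. Convexity of `H` gives `H' ≤ H`, and by rank one a strict inclusion would
  -- make `H` all of `K`.
  have hN := hφ'.isConradCone_extendCone (isConradCone_self H')
  have hH := hconv _ hN (hφ'.extendCone_ne hne' subset_rfl)
  have hle : H' ≤ H := fun x hx =>
    hH x 1 (Or.inr hx) (by rw [mul_one]; exact Or.inr (inv_mem hx)) (one_mem _)
  refine le_antisymm hle fun x hx => ?_
  by_contra hxH'
  exact hne.not_ge (hN.le_of_mem hφ' le_rfl hH hle (hφ.le hx) hxH' hx)

end Extend

theorem conradCones_bot : conradCones (⊥ : Subgroup G) = {{1}} := by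
  ext N
  constructor
  · intro hN
    have hN : IsConradCone ⊥ N := hN
    refine subset_antisymm (fun x hx => by simpa using hN.subset hx) ?_
    rintro _ rfl
    exact hN.one_mem_cone
  · rintro rfl
    rw [← Subgroup.coe_bot]
    exact isConradCone_self (⊥ : Subgroup G)

theorem conradOrderCones_bot : conradOrderCones (⊥ : Subgroup G) = {{1}} := by
  rw [← conradCones_bot]
  ext N
  refine ⟨fun h => h.1, fun h => ⟨h, fun g hg _ => ?_⟩⟩
  simpa using IsConradCone.subset h hg

namespace IsRigidSeries

variable {F : ℕ → Subgroup G} {n : ℕ} (hF : IsRigidSeries F n)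
include hF

theorem encard_conradCones : ∀ i ≤ n,
    (conradCones (F i)).encard = ((2 ^ (i + 1) - 1 : ℕ) : ℕ∞) := by
  intro i
  induction i with
  | zero => intro _; rw [hF.bot, conradCones_bot, Set.encard_singleton]; rfl
  | succ i ih =>
    intro hi
    obtain ⟨φ, hφ⟩ := hF.step i hi
    rw [hφ.encard_conradCones (hF.lt i hi) (hF.isConvexIn i hi), ih (by omega)]
    have : 2 ^ (i + 1 + 1) - 1 = 2 * (2 ^ (i + 1) - 1) + 1 := by
      have := Nat.one_le_two_pow (n := i + 1)
      rw [pow_succ 2 (i + 1)]; omega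
    rw [this]; push_cast; rfl

theorem encard_conradOrderCones : ∀ i ≤ n,
    (conradOrderCones (F i)).encard = ((2 ^ i : ℕ) : ℕ∞) := by
  intro i
  induction i with
  | zero => intro _; rw [hF.bot, conradOrderCones_bot, Set.encard_singleton]; rfl
  | succ i ih =>
    intro hi
    obtain ⟨φ, hφ⟩ := hF.step i hi
    rw [hφ.encard_conradOrderCones (hF.lt i hi) (hF.isConvexIn i hi), ih (by omega), pow_succ']
    push_cast; rfl

end IsRigidSeries

end Count

/-! ### Left-preorders as cones. -/

namespace LeftPreorder

variable {G : Type*} [Group G]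

/-- The cone of nonnegative elements. -/
def nonneg (L : LeftPreorder G) : Set G := {g | L.le 1 g}

theorem le_iff (L : LeftPreorder G) {a b : G} : L.le a b ↔ a⁻¹ * b ∈ L.nonneg := by
  constructor
  · intro h
    simpa [nonneg] using L.mul_le_mul_left a⁻¹ _ _ h
  · intro h
    simpa using L.mul_le_mul_left a _ _ h

theorem lt_iff (L : LeftPreorder G) {a b : G} : L.lt a b ↔ IsPos L.nonneg (a⁻¹ * b) := by
  simp [lt, IsPos, L.le_iff]

theorem nonneg_injective : Function.Injective (nonneg (G := G)) := by
  intro L L' h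
  ext a b
  rw [le_iff, le_iff, h]

theorem isConradCone_nonneg_iff (L : LeftPreorder G) :
    IsConradCone ⊤ L.nonneg ↔ L.IsConradian := by
  constructor
  · intro h a b ha hb
    rw [lt_iff, inv_one, one_mul] at ha hb
    obtain ⟨n, hn⟩ := h.conrad a b ha hb
    exact ⟨n, by rwa [lt_iff, ← mul_assoc]⟩
  · intro h
    refine ⟨fun g => ?_, fun a b ha hb => ?_, fun a b ha hb => ?_⟩
    · refine iff_of_true trivial ((L.le_total 1 g).imp id fun h1 => ?_)
      simpa using L.le_iff.1 h1
    · refine L.le_trans _ _ _ ha (L.le_iff.2 ?_)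
      simpa using hb
    · obtain ⟨n, hn⟩ := h a b (by simpa [lt_iff] using ha) (by simpa [lt_iff] using hb)
      exact ⟨n, by rwa [lt_iff, ← mul_assoc] at hn⟩

theorem nonneg_ne_univ (L : LeftPreorder G) : L.nonneg ≠ Set.univ := by
  intro h
  obtain ⟨a, b, hab⟩ := L.not_trivial
  rw [le_iff, h] at hab
  exact hab trivial

/-- The left-preorder with a given nonnegative cone. -/
def ofCone {N : Set G} (hN : IsConradCone ⊤ N) (hne : N ≠ Set.univ) : LeftPreorder G where
  le a b := a⁻¹ * b ∈ N
  le_refl a := by simpa using hN.one_mem_cone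
  le_trans a b c hab hbc := by simpa [mul_assoc] using hN.mul_closed _ _ hab hbc
  le_total a b := by simpa using hN.mem_or_inv_mem (g := a⁻¹ * b) trivial
  mul_le_mul_left g a b hab := by simpa [mul_assoc] using hab
  not_trivial := by
    obtain ⟨g, hg⟩ := (Set.ne_univ_iff_exists_notMem N).1 hne
    exact ⟨1, g, by simpa using hg⟩

theorem nonneg_ofCone {N : Set G} (hN : IsConradCone ⊤ N) (hne : N ≠ Set.univ) :
    (ofCone hN hne).nonneg = N := by
  ext g; simp [nonneg, ofCone]

theorem image_nonneg_COrd : nonneg '' COrd G = conradCones ⊤ \ {Set.univ} := by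
  ext N
  constructor
  · rintro ⟨L, hL, rfl⟩
    exact ⟨L.isConradCone_nonneg_iff.2 hL, L.nonneg_ne_univ⟩
  · rintro ⟨hN, hne⟩
    have hN : IsConradCone ⊤ N := hN
    have hne : N ≠ Set.univ := hne
    refine ⟨ofCone hN hne, ?_, nonneg_ofCone hN hne⟩
    change (ofCone hN hne).IsConradian
    rw [← isConradCone_nonneg_iff, nonneg_ofCone]
    exact hN

theorem residue_eq_bot_iff (L : LeftPreorder G) :
    L.residue = ⊥ ↔ ∀ g ∈ L.nonneg, g⁻¹ ∈ L.nonneg → g = 1 := by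
  have hmem : ∀ g, g ∈ L.residue ↔ g ∈ L.nonneg ∧ g⁻¹ ∈ L.nonneg := by
    intro g
    change L.le 1 g ∧ L.le g 1 ↔ _
    rw [L.le_iff, L.le_iff]; simp
  rw [Subgroup.eq_bot_iff_forall]
  simp only [hmem, and_imp]

/-- For the trivial group the only cone belongs to the trivial relation, which is not a
left-preorder; hence the instance argument. -/
theorem image_nonneg_COrdRel [Nontrivial G] :
    nonneg '' COrdRel G ⊥ = conradOrderCones ⊤ := by
  ext N
  constructor
  · rintro ⟨L, ⟨hL, hL'⟩, rfl⟩
    exact ⟨L.isConradCone_nonneg_iff.2 hL, L.residue_eq_bot_iff.1 hL'⟩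
  · rintro ⟨hN, hN1⟩
    have hne : N ≠ Set.univ := by
      rintro rfl
      obtain ⟨g, hg⟩ := exists_ne (1 : G)
      exact hg (hN1 g trivial trivial)
    refine ⟨ofCone hN hne, ⟨?_, ?_⟩, nonneg_ofCone hN hne⟩
    · rw [← isConradCone_nonneg_iff, nonneg_ofCone]
      exact hN
    · rw [residue_eq_bot_iff, nonneg_ofCone]
      exact hN1

end LeftPreorder

/-! ### Uniqueness of the rational series and the cardinalities. -/

namespace RationalSeries

variable {G : Type*} [Group G]

theorem hasAbelianJump_iff (s : RationalSeries G) : s.HasAbelianJump ↔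
    ∃ (i : ℕ) (hi : i + 2 ≤ s.length),
      ∀ a ∈ s.toFun ⟨i + 2, by omega⟩, ∀ b ∈ s.toFun ⟨i + 2, by omega⟩,
        a⁻¹ * b⁻¹ * a * b ∈ s.toFun ⟨i, by omega⟩ := by
  constructor
  · rintro ⟨i, hi, hn, hc⟩
    exact ⟨i, hi, quotient_mul_comm.1 hc⟩
  · rintro ⟨i, hi, hc⟩
    have hn := normal_subgroupOf_of_commutator hc
    exact ⟨i, hi, hn, quotient_mul_comm.2 hc⟩

/-- The terms of a series, continued by its last term. -/
def seq (s : RationalSeries G) (i : ℕ) : Subgroup G := s.toFun ⟨min i s.length, by omega⟩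

theorem seq_eq (s : RationalSeries G) {i : ℕ} (hi : i < s.length + 1) :
    s.seq i = s.toFun ⟨i, hi⟩ := by
  simp only [seq]
  congr 2
  omega

theorem isRationalStep_seq (s : RationalSeries G) {i : ℕ} (hi : i < s.length) :
    IsRationalStep (s.seq i) (s.seq (i + 1)) := by
  rw [s.seq_eq (by omega), s.seq_eq (by omega)]
  exact s.step ⟨i, hi⟩

theorem IsFull.seq_zero {s : RationalSeries G} (hs : s.IsFull) : s.seq 0 = ⊥ := by
  rw [s.seq_eq (by omega)]; exact hs.1

theorem IsFull.seq_length {s : RationalSeries G} (hs : s.IsFull) : s.seq s.length = ⊤ := by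
  rw [s.seq_eq (by omega)]; exact hs.2

theorem IsFull.isRigidSeries {s : RationalSeries G} (hs : s.IsFull) (hj : ¬ s.HasAbelianJump) :
    IsRigidSeries s.seq s.length where
  bot := hs.seq_zero
  lt i hi := (s.isRationalStep_seq hi).exists_isRatHom.1
  step i hi := (s.isRationalStep_seq hi).exists_isRatHom.2
  no_jump i hi hc := hj <| s.hasAbelianJump_iff.2 ⟨i, hi, by
    rwa [s.seq_eq (by omega), s.seq_eq (by omega)] at hc⟩

/-- A rational series without abelian jumps is the only rational series. -/
theorem IsFull.eq_of_not_hasAbelianJump {s t : RationalSeries G} (hs : s.IsFull)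
    (hj : ¬ s.HasAbelianJump) (ht : t.IsFull) : t = s := by
  have hF := hs.isRigidSeries hj
  -- The comparison runs downwards from `⊤`, because it is the penultimate term that is forced by
  -- the one above it.
  have key : ∀ k, k ≤ s.length → k ≤ t.length →
      t.seq (t.length - k) = s.seq (s.length - k) := by
    intro k
    induction k with
    | zero => intro _ _; rw [Nat.sub_zero, Nat.sub_zero, hs.seq_length, ht.seq_length]
    | succ k ih =>
      intro h1 h2
      have ih := ih (by omega) (by omega)
      obtain ⟨i, hi⟩ : ∃ i, s.length - k = i + 1 := ⟨s.length - k - 1, by omega⟩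
      obtain ⟨j, hj'⟩ : ∃ j, t.length - k = j + 1 := ⟨t.length - k - 1, by omega⟩
      rw [show s.length - (k + 1) = i by omega, show t.length - (k + 1) = j by omega]
      rw [hi, hj'] at ih
      obtain ⟨hlt, φ', hφ'⟩ := (t.isRationalStep_seq (show j < t.length by omega)).exists_isRatHom
      obtain ⟨φ, hφ⟩ := hF.step i (by omega)
      rw [ih] at hlt hφ'
      exact hφ.eq_of_isConvexIn (hF.lt i (by omega)) (hF.isConvexIn i (by omega)) hφ' hlt
  -- If one series reached `⊥` first, the other would still have a strict step below `⊥`.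
  have hlen : s.length = t.length := by
    rcases lt_trichotomy s.length t.length with h | h | h
    · have h1 := key s.length le_rfl h.le
      obtain ⟨j, hj'⟩ : ∃ j, t.length - s.length = j + 1 := ⟨t.length - s.length - 1, by omega⟩
      rw [Nat.sub_self, hs.seq_zero, hj'] at h1
      have := (t.isRationalStep_seq (show j < t.length by omega)).exists_isRatHom.1
      rw [h1] at this
      exact absurd this not_lt_bot
    · exact h
    · have h1 := key t.length h.le le_rfl
      obtain ⟨j, hj'⟩ : ∃ j, s.length - t.length = j + 1 := ⟨s.length - t.length - 1, by omega⟩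
      rw [Nat.sub_self, ht.seq_zero, hj'] at h1
      have := hF.lt j (by omega)
      rw [← h1] at this
      exact absurd this not_lt_bot
  refine RelSeries.ext hlen.symm (funext fun i => ?_)
  have h1 := key (t.length - i) (by omega) (by omega)
  rw [show t.length - (t.length - i) = i by omega, show s.length - (t.length - i) = i by omega,
    s.seq_eq (by omega), t.seq_eq (by omega)] at h1
  exact h1

theorem IsFull.encard {s : RationalSeries G} [Nontrivial G] (hs : s.IsFull)
    (hj : ¬ s.HasAbelianJump) :
    (COrd G).encard = ((2 ^ (s.length + 1) - 2 : ℕ) : ℕ∞) ∧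
      (COrdRel G ⊥).encard = ((2 ^ s.length : ℕ) : ℕ∞) := by
  have hF := hs.isRigidSeries hj
  have h1 := hF.encard_conradCones _ le_rfl
  have h2 := hF.encard_conradOrderCones _ le_rfl
  rw [hs.seq_length] at h1 h2
  refine ⟨?_, ?_⟩
  -- The trivial relation is a cone but not a left-preorder, which lowers the count by one.
  · have huniv : (Set.univ : Set G) ∈ conradCones ⊤ := isConradCone_self (⊤ : Subgroup G)
    rw [← LeftPreorder.nonneg_injective.encard_image, LeftPreorder.image_nonneg_COrd,
      Set.encard_sdiff_singleton_of_mem huniv, h1]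
    norm_cast
  · rw [← LeftPreorder.nonneg_injective.encard_image, LeftPreorder.image_nonneg_COrdRel, h2]

end RationalSeries

/-! ### Modifying a cone, and the structure of isolated orders. -/

section Modify

variable {G : Type*} [Group G] {K E D : Subgroup G} {N M : Set G}

theorem IsConvexIn.mul_notMem (hE : IsConvexIn N E) {a b : G} (ha : a ∈ N) (haE : a ∉ E)
    (hb : b ∈ N) : a * b ∉ E :=
  fun hab => haE (hE a (a * b) ha (by simpa using hb) hab)

/-- The cone obtained by replacing the preorder on the convex subgroup `E`. -/
def replaceCone (N : Set G) (E : Subgroup G) (M : Set G) : Set G := {g | g ∈ N ∧ g ∉ E} ∪ M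

theorem mem_replaceCone_of_notMem (hM : M ⊆ E) {g : G} (hg : g ∉ E) :
    g ∈ replaceCone N E M ↔ g ∈ N :=
  ⟨fun h => h.elim (fun h => h.1) fun h => absurd (hM h) hg, fun h => Or.inl ⟨h, hg⟩⟩

theorem mem_replaceCone_of_mem {g : G} (hg : g ∈ E) : g ∈ replaceCone N E M ↔ g ∈ M :=
  ⟨fun h => h.elim (fun h => absurd hg h.2) id, Or.inr⟩

theorem IsConradCone.replaceCone (h : IsConradCone K N) (hEK : E ≤ K) (hE : IsConvexIn N E)
    (hM : IsConradCone E M) : IsConradCone K (replaceCone N E M) := by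
  have hout : ∀ g, g ∉ E → (g ∈ _root_.replaceCone N E M ↔ g ∈ N) :=
    fun g => mem_replaceCone_of_notMem hM.subset
  have hin : ∀ g, g ∈ E → (g ∈ _root_.replaceCone N E M ↔ g ∈ M) :=
    fun g => mem_replaceCone_of_mem
  have hpos : ∀ g, g ∉ E → g ∈ N → IsPos (_root_.replaceCone N E M) g := fun g hg hgN =>
    ⟨(hout g hg).2 hgN, by
      rw [hout _ (by simpa using hg)]; exact (hE.isPos_of_notMem hgN hg).2⟩
  have hpos' : ∀ g, g ∈ E → (IsPos (_root_.replaceCone N E M) g ↔ IsPos M g) := fun g hg => by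
    simp only [IsPos, hin g hg, hin g⁻¹ (inv_mem hg)]
  refine ⟨fun g => ?_, fun a b ha hb => ?_, fun a b ha hb => ?_⟩
  · by_cases hg : g ∈ E
    · rw [hin g hg, hin _ (inv_mem hg), ← hM.mem_iff]
      exact iff_of_true (hEK hg) hg
    · rw [hout g hg, hout _ (by simpa using hg), ← h.mem_iff]
  · by_cases haE : a ∈ E
    · rw [hin a haE] at ha
      by_cases hbE : b ∈ E
      · rw [hin b hbE] at hb
        rw [hin _ (mul_mem haE hbE)]
        exact hM.mul_closed a b ha hb
      · rw [hout b hbE] at hb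
        rw [hout _ fun hab => hbE ((E.mul_mem_cancel_left haE).1 hab)]
        exact (h.isPos_mul_left hEK hE hb hbE haE).1
    · rw [hout a haE] at ha
      by_cases hbE : b ∈ E
      · rw [hout _ fun hab => haE ((E.mul_mem_cancel_right hbE).1 hab)]
        exact (h.isPos_mul_right hEK hE ha haE hbE).1
      · rw [hout b hbE] at hb
        rw [hout _ (hE.mul_notMem ha haE hb)]
        exact h.mul_closed a b ha hb
  · by_cases haE : a ∈ E
    · by_cases hbE : b ∈ E
      · rw [hpos' a haE] at ha
        rw [hpos' b hbE] at hb
        obtain ⟨n, hn⟩ := hM.conrad a b ha hb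
        exact ⟨n, (hpos' _ (mul_mem (mul_mem (inv_mem haE) hbE) (pow_mem haE n))).2 hn⟩
      · have hbN := (hout b hbE).1 hb.1
        refine ⟨0, ?_⟩
        rw [pow_zero, mul_one]
        exact hpos _ (fun hab => hbE ((E.mul_mem_cancel_left (inv_mem haE)).1 hab))
          (h.isPos_mul_left hEK hE hbN hbE (inv_mem haE)).1
    · have haN := (hout a haE).1 ha.1
      -- If `b` lies in `E`, its sign for `N` is unknown, but `b * a` is outside `E` and positive.
      -- The conradian property is applied to `a` and `b * a`, and a last factor `a` is added should
      -- the result fall in `E`.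
      have hba : b * a ∈ N ∧ b * a ∉ E := by
        by_cases hbE : b ∈ E
        · exact ⟨(h.isPos_mul_left hEK hE haN haE hbE).1,
            fun hab => haE ((E.mul_mem_cancel_left hbE).1 hab)⟩
        · have hbN := (hout b hbE).1 hb.1
          exact ⟨h.mul_closed _ _ hbN haN, hE.mul_notMem hbN hbE haN⟩
      obtain ⟨n, hn⟩ := h.conrad a (b * a) (hE.isPos_of_notMem haN haE)
        (hE.isPos_of_notMem hba.1 hba.2)
      have h1 : a⁻¹ * (b * a) * a ^ n = a⁻¹ * b * a ^ (n + 1) := by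
        rw [pow_succ']; group
      rw [h1] at hn
      by_cases hc : a⁻¹ * b * a ^ (n + 1) ∈ E
      · refine ⟨n + 2, ?_⟩
        rw [pow_succ a (n + 1), ← mul_assoc]
        exact hpos _ (fun hab => haE ((E.mul_mem_cancel_left hc).1 hab))
          (h.isPos_mul_left hEK hE haN haE hc).1
      · exact ⟨n + 1, hpos _ hc hn.1⟩

/-- The cone obtained by reversing the preorder outside the convex subgroup `D`. -/
def flipCone (E D : Subgroup G) (N : Set G) : Set G := {g | g ∈ E ∧ g ∉ D ∧ g⁻¹ ∈ N} ∪ (N ∩ D)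

theorem mem_flipCone_of_notMem {g : G} (hgE : g ∈ E) (hg : g ∉ D) :
    g ∈ flipCone E D N ↔ g⁻¹ ∈ N :=
  ⟨fun h => h.elim (fun h => h.2.2) fun h => absurd h.2 hg, fun h => Or.inl ⟨hgE, hg, h⟩⟩

theorem mem_flipCone_of_mem {g : G} (hg : g ∈ D) : g ∈ flipCone E D N ↔ g ∈ N :=
  ⟨fun h => h.elim (fun h => absurd hg h.2.1) fun h => h.1, fun h => Or.inr ⟨h, hg⟩⟩

theorem IsConradCone.flipCone (h : IsConradCone E N) (hDE : D ≤ E) (hD : IsConvexIn N D)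
    (hc : ∀ a ∈ E, ∀ b ∈ E, a⁻¹ * b⁻¹ * a * b ∈ D) : IsConradCone E (flipCone E D N) := by
  have hout : ∀ g ∈ E, g ∉ D → (g ∈ _root_.flipCone E D N ↔ g⁻¹ ∈ N) :=
    fun g => mem_flipCone_of_notMem
  have hin : ∀ g, g ∈ D → (g ∈ _root_.flipCone E D N ↔ g ∈ N) := fun g => mem_flipCone_of_mem
  have hsub : _root_.flipCone E D N ⊆ E := by
    rintro g (hg | hg)
    exacts [hg.1, hDE hg.2]
  have hmul : ∀ a b, a ∈ _root_.flipCone E D N → b ∈ _root_.flipCone E D N →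
      a * b ∈ _root_.flipCone E D N := by
    intro a b ha hb
    have haE := hsub ha
    have hbE := hsub hb
    by_cases haD : a ∈ D
    · rw [hin a haD] at ha
      by_cases hbD : b ∈ D
      · rw [hin b hbD] at hb
        rw [hin _ (mul_mem haD hbD)]
        exact h.mul_closed a b ha hb
      · rw [hout b hbE hbD] at hb
        rw [hout _ (mul_mem haE hbE) fun hab => hbD ((D.mul_mem_cancel_left haD).1 hab),
          mul_inv_rev]
        exact (h.isPos_mul_right hDE hD hb (by simpa using hbD) (inv_mem haD)).1
    · rw [hout a haE haD] at ha
      by_cases hbD : b ∈ D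
      · rw [hout _ (mul_mem haE hbE) fun hab => haD ((D.mul_mem_cancel_right hbD).1 hab),
          mul_inv_rev]
        exact (h.isPos_mul_left hDE hD ha (by simpa using haD) (inv_mem hbD)).1
      · rw [hout b hbE hbD] at hb
        have := hD.mul_notMem hb (by simpa using hbD) ha
        rw [← mul_inv_rev, D.inv_mem_iff] at this
        rw [hout _ (mul_mem haE hbE) this, mul_inv_rev]
        exact h.mul_closed _ _ hb ha
  have hpos : ∀ g ∈ _root_.flipCone E D N, g ∉ D → IsPos (_root_.flipCone E D N) g := by
    intro g hg hgD
    have hgE := hsub hg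
    refine ⟨hg, ?_⟩
    rw [hout _ (inv_mem hgE) (by simpa using hgD), inv_inv]
    have := (hD.isPos_of_notMem ((hout g hgE hgD).1 hg) (by simpa using hgD)).2
    simpa using this
  have hpos' : ∀ g, g ∈ D → (IsPos (_root_.flipCone E D N) g ↔ IsPos (N ∩ D) g) := fun g hg => by
    simp only [IsPos, hin g hg, hin g⁻¹ (inv_mem hg), Set.mem_inter_iff, SetLike.mem_coe, hg,
      inv_mem hg, and_true]
  refine ⟨fun g => ⟨fun hg => ?_, ?_⟩, hmul, fun a b ha hb => ?_⟩
  · by_cases hgD : g ∈ D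
    · rw [hin g hgD, hin _ (inv_mem hgD)]
      exact h.mem_or_inv_mem hg
    · rw [hout g hg hgD, hout _ (inv_mem hg) (by simpa using hgD), inv_inv]
      exact (h.mem_or_inv_mem hg).symm
  · rintro (hg | hg)
    · exact hsub hg
    · simpa using hsub hg
  · have haE := hsub ha.1
    have hbE := hsub hb.1
    by_cases haD : a ∈ D
    · by_cases hbD : b ∈ D
      · rw [hpos' a haD] at ha
        rw [hpos' b hbD] at hb
        obtain ⟨n, hn⟩ := (h.inter hDE).conrad a b ha hb
        exact ⟨n, (hpos' _ (mul_mem (mul_mem (inv_mem haD) hbD) (pow_mem haD n))).2 hn⟩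
      · refine ⟨0, ?_⟩
        rw [pow_zero, mul_one]
        have hab : a⁻¹ * b ∉ D := fun hab => hbD ((D.mul_mem_cancel_left (inv_mem haD)).1 hab)
        refine hpos _ ?_ hab
        rw [hout _ (mul_mem (inv_mem haE) hbE) hab, mul_inv_rev]
        exact (h.isPos_mul_right hDE hD ((hout b hbE hbD).1 hb.1) (by simpa using hbD)
          (by simpa using haD)).1
    · have haN := (hout a haE haD).1 ha.1
      set d := b⁻¹ * a⁻¹ * b * a with hd
      have hdD : d ∈ D := by simpa using hc b hbE a haE
      have hda : d * a ∉ D := fun hda => haD ((D.mul_mem_cancel_left hdD).1 hda)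
      have hdaE : d * a ∈ E := mul_mem (hDE hdD) haE
      have hdaN : (d * a)⁻¹ ∈ N := by
        rw [mul_inv_rev]
        exact (h.isPos_mul_right hDE hD haN (by simpa using haD) (inv_mem hdD)).1
      -- Since `E / D` is abelian, `a⁻¹ * b * a ^ 2` is `b * a` up to the commutator `d` in `D`,
      -- which does not affect the sign of `a`.
      have heq : a⁻¹ * b * a ^ 2 = b * (d * a) := by rw [hd, sq]; group
      refine ⟨2, ?_⟩
      rw [heq]
      refine hpos _ (hmul _ _ hb.1 ((hout _ hdaE hda).2 hdaN)) fun hmem => ?_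
      by_cases hbD : b ∈ D
      · exact hda ((D.mul_mem_cancel_left hbD).1 hmem)
      · refine hD.mul_notMem hdaN (fun hi => hda (D.inv_mem_iff.1 hi)) ((hout b hbE hbD).1 hb.1) ?_
        rw [← mul_inv_rev]
        exact inv_mem hmem

/-- The kernel of a map which is additive on `E`. -/
def ratKer {φ : G → ℚ} (h : ∀ a ∈ E, ∀ b ∈ E, φ (a * b) = φ a + φ b) : Subgroup G where
  carrier := {g | g ∈ E ∧ φ g = 0}
  one_mem' := ⟨one_mem _, map_one_of_map_mul h⟩
  mul_mem' := by
    rintro a b ⟨ha, ha0⟩ ⟨hb, hb0⟩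
    exact ⟨mul_mem ha hb, by rw [h a ha b hb, ha0, hb0, add_zero]⟩
  inv_mem' := by
    rintro a ⟨ha, ha0⟩
    exact ⟨inv_mem ha, by rw [map_inv_of_map_mul h ha, ha0, neg_zero]⟩

theorem isRatHom_ratKer {φ : G → ℚ} (h : ∀ a ∈ E, ∀ b ∈ E, φ (a * b) = φ a + φ b) :
    IsRatHom (ratKer h) E φ :=
  ⟨fun _ hg => hg.1, h, fun _ ha => ⟨fun h0 => ⟨ha, h0⟩, fun h0 => h0.2⟩⟩

/-- The conradian left-order with cone `N` is the only one for which all the elements of the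
finite set `S` are nonnegative. -/
structure IsIsolatedCone (N S : Set G) : Prop where
  mem : N ∈ conradOrderCones (⊤ : Subgroup G)
  finite : S.Finite
  pos : ∀ s ∈ S, IsPos N s
  eq : ∀ N' ∈ conradOrderCones (⊤ : Subgroup G), S ⊆ N' → N' = N

namespace IsIsolatedCone

variable {S : Set G} (h : IsIsolatedCone N S)
include h

theorem isPos_of_ne_one {g : G} (hg : g ∈ N) (hg1 : g ≠ 1) : IsPos N g :=
  ⟨hg, fun hgi => hg1 (h.mem.2 g hg hgi)⟩

/-- A homomorphism on a convex subgroup that is positive on the relevant elements of `S` has a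
convex kernel. -/
theorem isRatHom (hDE : D ≤ E) (hD : IsConvexIn N D) (hE : IsConvexIn N E)
    (hc : ∀ a ∈ E, ∀ b ∈ E, a⁻¹ * b⁻¹ * a * b ∈ D) {φ : G → ℚ}
    (hφ : ∀ a ∈ E, ∀ b ∈ E, φ (a * b) = φ a + φ b) (hφD : ∀ a ∈ D, φ a = 0)
    (hφS : ∀ s ∈ S, s ∈ E → s ∉ D → 0 < φ s) : IsRatHom D E φ := by
  have hR := isRatHom_ratKer hφ
  have hDK : D ≤ ratKer hφ := fun x hx => ⟨hDE hx, hφD x hx⟩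
  set K₀ := ratKer hφ with hK₀
  have hN := h.mem.1
  have hI := hN.inter (le_top : K₀ ≤ ⊤)
  have hDI : IsConvexIn (N ∩ K₀) D := fun x g hx hxg hg => hD x g hx.1 hxg.1 hg
  have hflip := hI.flipCone hDK hDI fun a ha b hb => hc a (hR.le ha) b (hR.le hb)
  have hflip1 : flipCone K₀ D (N ∩ K₀) ∈ conradOrderCones K₀ := by
    refine ⟨hflip, fun g hg hgi => ?_⟩
    have hgK := hflip.subset hg
    by_cases hgD : g ∈ D
    · rw [mem_flipCone_of_mem hgD] at hg
      rw [mem_flipCone_of_mem (inv_mem hgD)] at hgi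
      exact h.mem.2 g hg.1 hgi.1
    · rw [mem_flipCone_of_notMem hgK hgD] at hg
      rw [mem_flipCone_of_notMem (inv_mem hgK) (by simpa using hgD), inv_inv] at hgi
      exact h.mem.2 g hgi.1 hg.1
  have hext := hR.extendCone_mem_conradOrderCones hflip1
  have hnew := hN.replaceCone le_top hE hext.1
  -- The modified order keeps `S` positive, so it is the old one. A positive element of the kernel
  -- outside `D` would have been reversed, so the kernel is `D`.
  have heq := h.eq _ ⟨hnew, fun g hg hgi => ?_⟩ fun s hs => ?_
  · have key : ∀ x ∈ K₀, x ∈ N → x ∈ D := by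
      intro x hx hxN
      by_contra hxD
      have h1 := hxN
      rw [← heq, mem_replaceCone_of_mem (hR.le hx)] at h1
      have h2 : x ∈ flipCone K₀ D (N ∩ K₀) := by
        rcases h1 with h1 | h1
        · exact absurd hx.2 h1.2.ne'
        · exact h1
      rw [mem_flipCone_of_notMem hx hxD] at h2
      exact hxD (h.mem.2 x hxN h2.1 ▸ one_mem D)
    have hKD : K₀ = D := by
      refine le_antisymm (fun x hx => ?_) hDK
      rcases hN.mem_or_inv_mem (g := x) trivial with h1 | h1
      · exact key x hx h1
      · exact D.inv_mem_iff.1 (key _ (inv_mem hx) h1)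
    rwa [hKD] at hR
  · by_cases hgE : g ∈ E
    · rw [mem_replaceCone_of_mem hgE] at hg
      rw [mem_replaceCone_of_mem (inv_mem hgE)] at hgi
      exact hext.2 g hg hgi
    · rw [mem_replaceCone_of_notMem hext.1.subset hgE] at hg
      rw [mem_replaceCone_of_notMem hext.1.subset (by simpa using hgE)] at hgi
      exact h.mem.2 g hg hgi
  · have hsN := (h.pos s hs).1
    by_cases hsE : s ∈ E
    · rw [mem_replaceCone_of_mem hsE]
      by_cases hsD : s ∈ D
      · refine Or.inr ?_
        rw [mem_flipCone_of_mem hsD]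
        exact ⟨hsN, hDK hsD⟩
      · exact Or.inl ⟨hsE, hφS s hs hsE hsD⟩
    · rwa [mem_replaceCone_of_notMem hext.1.subset hsE]

/-- If `S` missed the jump, the zero map would qualify in `isRatHom`, and its kernel is all of `E`.
-/
theorem exists_mem (hDE : D < E) (hD : IsConvexIn N D) (hE : IsConvexIn N E)
    (hc : ∀ a ∈ E, ∀ b ∈ E, a⁻¹ * b⁻¹ * a * b ∈ D) : ∃ s ∈ S, s ∈ E ∧ s ∉ D := by
  by_contra hcon
  push Not at hcon
  have := h.isRatHom (φ := 0) hDE.le hD hE hc (by simp) (by simp)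
    fun s hs hsE hsD => absurd (hcon s hs hsE) hsD
  exact hDE.not_ge fun x hx => (this.eq_zero_iff x hx).1 rfl

theorem exists_isRatHom (hDE : D ≤ E) (hD : IsConvexIn N D) (hE : IsConvexIn N E)
    (hc : ∀ a ∈ E, ∀ b ∈ E, a⁻¹ * b⁻¹ * a * b ∈ D) : ∃ φ, IsRatHom D E φ := by
  obtain ⟨φ, h1, h2, h3⟩ := exists_ratHom_pos hDE hc {g | g ∈ N ∧ g ∈ E ∧ g ∉ D}
    (fun g hg => hg.2.1) (fun g hg => hg.2.2)
    (fun a ha b hb => ⟨h.mem.1.mul_closed _ _ ha.1 hb.1, mul_mem ha.2.1 hb.2.1,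
      hD.mul_notMem ha.1 ha.2.2 hb.1⟩)
    {s | s ∈ S ∧ s ∈ E ∧ s ∉ D} (h.finite.subset fun s hs => hs.1)
    (fun s hs => ⟨(h.pos s hs.1).1, hs.2⟩)
  exact ⟨φ, h.isRatHom hDE hD hE hc h1 h2 fun s hs hsE hsD => h3 s ⟨hs, hsE, hsD⟩⟩

omit h in
theorem _root_.IsConradCone.exists_max (hN : IsConradCone ⊤ N) {T : Set G} (hT : T.Finite)
    (hne : T.Nonempty) : ∃ s ∈ T, ∀ t ∈ T, t⁻¹ * s ∈ N := by
  induction T, hT using Set.Finite.induction_on with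
  | empty => exact absurd hne Set.not_nonempty_empty
  | @insert a T ha hT ih =>
    rcases T.eq_empty_or_nonempty with rfl | hT'
    · exact ⟨a, by simp, by simpa using hN.one_mem_cone⟩
    · obtain ⟨s, hs, hmax⟩ := ih hT'
      rcases hN.mem_or_inv_mem (g := a⁻¹ * s) trivial with h1 | h1
      · refine ⟨s, Or.inr hs, ?_⟩
        rintro t (rfl | ht)
        exacts [h1, hmax t ht]
      · refine ⟨a, Or.inl rfl, ?_⟩
        rintro t (rfl | ht)
        · simpa using hN.one_mem_cone
        · simpa [mul_assoc] using hN.mul_closed _ _ (hmax t ht) h1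

/-- The convex subgroup `M` is the top of the jump of the largest element `t` of `S` in `M`. The
bottom of that jump loses `t`, so the number of elements of `S` drops. -/
theorem exists_series : ∀ (k : ℕ) (M : Subgroup G), IsConvexIn N M → (S ∩ M).ncard = k →
    ∃ s : RationalSeries G, s.head = ⊥ ∧ s.last = M ∧ ∀ H ∈ s, IsConvexIn N H := by
  intro k
  induction k using Nat.strong_induction_on with
  | _ k ih =>
  intro M hM hk
  by_cases hbot : M = ⊥
  · refine ⟨RelSeries.singleton _ ⊥, rfl, hbot.symm, ?_⟩
    rintro H ⟨i, rfl⟩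
    exact hbot ▸ hM
  have hN := h.mem.1
  have hjump : ∀ m ∈ M, m ∈ N → m ≠ 1 → ∃ D E, IsJump ⊤ N m D E ∧ ∃ s ∈ S ∩ M, s ∈ E ∧ s ∉ D := by
    intro m hm hmN hm1
    obtain ⟨D, E, hJ⟩ := hN.exists_isJump (h.isPos_of_ne_one hmN hm1)
    obtain ⟨s, hs, hsE, hsD⟩ := h.exists_mem
      (lt_of_le_of_ne hJ.le fun heq => hJ.notMem_bot (heq ▸ hJ.mem_top))
      hJ.convex_bot hJ.convex_top hJ.commutator_mem
    exact ⟨D, E, hJ, s, ⟨hs, hJ.top_le M le_top hM hm hsE⟩, hsE, hsD⟩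
  have hne : (S ∩ M).Nonempty := by
    obtain ⟨m, hm, hm1⟩ := M.bot_or_exists_ne_one.resolve_left hbot
    rcases hN.mem_or_inv_mem (g := m) trivial with h1 | h1
    · obtain ⟨-, -, -, s, hs, -⟩ := hjump m hm h1 hm1
      exact ⟨s, hs⟩
    · obtain ⟨-, -, -, s, hs, -⟩ := hjump m⁻¹ (inv_mem hm) h1 (by simpa using hm1)
      exact ⟨s, hs⟩
  have hfin : (S ∩ M).Finite := h.finite.subset Set.inter_subset_left
  obtain ⟨t, ht, hmax⟩ := hN.exists_max hfin hne
  obtain ⟨D, E, hJ⟩ := hN.exists_isJump (h.pos t ht.1)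
  have hkey : ∀ m ∈ M, m ∈ N → m ∈ E := by
    intro m hm hmN
    by_cases hm1 : m = 1
    · rw [hm1]; exact one_mem _
    -- The jump of `m` contains some `s` from `S`; since `s ≤ t`, it lies in `E`, and then so does
    -- `m`.
    obtain ⟨D', E', hJ', s, hs, hsE', hsD'⟩ := hjump m hm hmN hm1
    exact hJ'.mem_of_notMem_bot E le_top hJ.convex_top s
      (hJ.convex_top s t (h.pos s hs.1).1 (hmax s hs) hJ.mem_top) hsD'
  have hEM : E = M := by
    refine le_antisymm (hJ.top_le M le_top hM ht.2) fun m hm => ?_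
    rcases hN.mem_or_inv_mem (g := m) trivial with h1 | h1
    · exact hkey m hm h1
    · exact E.inv_mem_iff.1 (hkey _ (inv_mem hm) h1)
  subst hEM
  obtain ⟨φ, hφ⟩ := h.exists_isRatHom hJ.le hJ.convex_bot hJ.convex_top hJ.commutator_mem
  have hstep := hφ.isRationalStep fun heq => hJ.notMem_bot (heq ▸ hJ.mem_top)
  have hlt : (S ∩ D).ncard < k := by
    rw [← hk]
    refine Set.ncard_lt_ncard ⟨Set.inter_subset_inter_right S hJ.le, fun hsub => ?_⟩ hfin
    exact hJ.notMem_bot (hsub ht).2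
  obtain ⟨s, hs1, hs2, hs3⟩ := ih _ hlt D hJ.convex_bot rfl
  refine ⟨s.snoc E (by rw [hs2]; exact hstep), by simpa using hs1, by simp, fun H hH => ?_⟩
  rcases RelSeries.mem_snoc.1 hH with hH | rfl
  · exact hs3 H hH
  · exact hJ.convex_top

theorem exists_isFull : ∃ s : RationalSeries G, s.IsFull ∧ ¬ s.HasAbelianJump := by
  obtain ⟨s, hs1, hs2, hs3⟩ := h.exists_series _ ⊤ (fun _ _ _ _ _ => trivial) rfl
  refine ⟨s, ⟨hs1, hs2⟩, fun hj => ?_⟩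
  obtain ⟨i, hi, hc⟩ := s.hasAbelianJump_iff.1 hj
  have hconv : ∀ j, IsConvexIn N (s.toFun j) := fun j => hs3 _ ⟨j, rfl⟩
  have h1 := (show IsRationalStep _ _ from s.step ⟨i, by omega⟩).exists_isRatHom.1
  have h2 := (show IsRationalStep _ _ from s.step ⟨i + 1, by omega⟩).exists_isRatHom.1
  -- An abelian double step between convex subgroups would have rank one, which leaves no room for
  -- the convex term in the middle.
  obtain ⟨φ, hφ⟩ := h.exists_isRatHom (h1.le.trans h2.le) (hconv _) (hconv _) hc
  obtain ⟨g, hg, hg'⟩ := SetLike.exists_of_lt h1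
  exact h2.not_ge (h.mem.1.le_of_mem hφ le_top (hconv _) h1.le (h2.le hg) hg' hg)

end IsIsolatedCone

end Modify

/-! ### The topology and finite determination of isolated orders. -/

namespace LeftPreorder

variable {G : Type*} [Group G]

theorem signMap_eq_one {L : LeftPreorder G} {g : G} (hg : IsPos L.nonneg g) :
    L.signMap g = 1 := by
  rw [signMap, if_pos]
  simpa [lt_iff] using hg

theorem signMap_eq_neg_one {L : LeftPreorder G} {g : G} (hg : IsPos L.nonneg g⁻¹) :
    L.signMap g = -1 := by
  have h1 : ¬ IsPos L.nonneg g := fun h => h.2 hg.1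
  rw [signMap, if_neg, if_pos]
  · simpa [lt_iff] using hg
  · simpa [lt_iff] using h1

theorem signMap_eq_zero {L : LeftPreorder G} {g : G} (hg : ¬ IsPos L.nonneg g)
    (hg' : ¬ IsPos L.nonneg g⁻¹) : L.signMap g = 0 := by
  rw [signMap, if_neg, if_neg]
  · simpa [lt_iff] using hg'
  · simpa [lt_iff] using hg

theorem mem_nonneg_iff (L : LeftPreorder G) (g : G) : g ∈ L.nonneg ↔ L.signMap g ≠ -1 := by
  have htot : g ∈ L.nonneg ∨ g⁻¹ ∈ L.nonneg := by
    simpa [nonneg, L.le_iff (a := g)] using L.le_total 1 g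
  by_cases h1 : IsPos L.nonneg g
  · rw [signMap_eq_one h1]
    exact iff_of_true h1.1 (by decide)
  · by_cases h2 : IsPos L.nonneg g⁻¹
    · rw [signMap_eq_neg_one h2]
      exact iff_of_false (by simpa using h2.2) (by simp)
    · rw [signMap_eq_zero h1 h2]
      refine iff_of_true ?_ (by decide)
      simp only [IsPos, inv_inv] at h1 h2
      tauto

theorem signMap_injective : Function.Injective (signMap (G := G)) := by
  intro L L' h
  refine nonneg_injective (Set.ext fun g => ?_)
  rw [mem_nonneg_iff, mem_nonneg_iff, h]

instance : T1Space (LeftPreorder G) :=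
  t1Space_of_injective_of_continuous signMap_injective continuous_induced_dom

theorem isOpen_singleton_of_finite {s : Set (LeftPreorder G)} (hs : s.Finite) (L : s) :
    IsOpen ({L} : Set s) := by
  have := hs.to_subtype
  exact isOpen_discrete _

/-- An isolated conradian left-order is determined by finitely many positive elements. -/
theorem exists_isIsolatedCone [Nontrivial G] {L : COrdRel G ⊥}
    (hL : IsOpen ({L} : Set (COrdRel G ⊥))) : ∃ S, IsIsolatedCone L.1.nonneg S := by
  have hmem : ∀ L : COrdRel G ⊥, L.1.nonneg ∈ conradOrderCones ⊤ := fun L => by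
    rw [← image_nonneg_COrdRel]; exact ⟨_, L.2, rfl⟩
  have hpos : ∀ L : COrdRel G ⊥, ∀ g ∈ L.1.nonneg, g ≠ 1 → IsPos L.1.nonneg g :=
    fun L g hg hg1 => ⟨hg, fun hgi => hg1 ((hmem L).2 g hg hgi)⟩
  obtain ⟨U, hU, hUL⟩ := isOpen_induced_iff.1 hL
  obtain ⟨V, hV, rfl⟩ := isOpen_induced_iff.1 hU
  have hLV : L.1.signMap ∈ V := by
    have : L ∈ Subtype.val ⁻¹' (signMap ⁻¹' V) := hUL ▸ rfl
    exact this
  obtain ⟨I, u, hu, hIV⟩ := isOpen_pi_iff.1 hV _ hLV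
  -- A basic neighbourhood prescribes signs on a finite set `I`. For a left-order this amounts to
  -- positivity of `i` or `i⁻¹` for each `i ≠ 1` in `I`; the sign at `1` is always `0`.
  refine ⟨{s | IsPos L.1.nonneg s ∧ (s ∈ I ∨ s⁻¹ ∈ I)}, hmem L, ?_, fun s hs => hs.1, ?_⟩
  · refine (I.finite_toSet.union (I.finite_toSet.image (·⁻¹))).subset ?_
    rintro s ⟨-, hs | hs⟩
    exacts [Or.inl hs, Or.inr ⟨_, hs, inv_inv s⟩]
  · intro N' hN' hS
    rw [← image_nonneg_COrdRel] at hN'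
    obtain ⟨L', hL', rfl⟩ := hN'
    suffices (⟨L', hL'⟩ : COrdRel G ⊥) = L by rw [← this]
    have hL'V : (⟨L', hL'⟩ : COrdRel G ⊥) ∈ Subtype.val ⁻¹' (signMap ⁻¹' V) := by
      refine hIV fun i hi => ?_
      have : L'.signMap i = L.1.signMap i := by
        by_cases hi1 : i = 1
        · have hone : ∀ L : LeftPreorder G, L.signMap i = 0 := fun L => by
            refine signMap_eq_zero ?_ ?_ <;> rw [hi1] <;> simp [IsPos]
          rw [hone, hone]
        · rcases (hmem L).1.mem_or_inv_mem (g := i) trivial with h1 | h1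
          · have h2 := hpos L i h1 hi1
            rw [signMap_eq_one h2, signMap_eq_one (hpos ⟨L', hL'⟩ i (hS ⟨h2, Or.inl hi⟩) hi1)]
          · have hi1' : i⁻¹ ≠ 1 := by simpa using hi1
            have h2 := hpos L _ h1 hi1'
            rw [signMap_eq_neg_one h2, signMap_eq_neg_one
              (hpos ⟨L', hL'⟩ _ (hS ⟨h2, Or.inr (by simpa using hi)⟩) hi1')]
      rw [this]
      exact (hu i hi).2
    rw [hUL] at hL'V
    exact hL'V

end LeftPreorder

/-! ### The equivalences. -/

theorem mainTheorem7 (G : Type*) [Group G]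
    (hG : ∃ L : LeftPreorder G, L.IsLeftOrder ∧ L.IsConradian) :
    List.TFAE [
      ∃ L : COrdRel G ⊥, IsOpen ({L} : Set (COrdRel G ⊥)),
      ∀ L : COrdRel G ⊥, IsOpen ({L} : Set (COrdRel G ⊥)),
      ∀ L : COrd G, IsOpen ({L} : Set (COrd G)),
      ∃ s : RationalSeries G, s.IsFull ∧ ¬ RationalSeries.HasAbelianJump s,
      ∃ s : RationalSeries G, (s.IsFull ∧ ∀ t : RationalSeries G, t.IsFull → t = s) ∧
        ¬ RationalSeries.HasAbelianJump s,
      (COrdRel G ⊥).Finite,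
      (COrd G).Finite] ∧
    ∀ s : RationalSeries G, s.IsFull → ¬ RationalSeries.HasAbelianJump s →
      (COrd G).encard = ((2 ^ (s.length + 1) - 2 : ℕ) : ℕ∞) ∧
      (COrdRel G ⊥).encard = ((2 ^ s.length : ℕ) : ℕ∞) := by
  obtain ⟨L₀, hL₀, hL₀'⟩ := hG
  have hnt : Nontrivial G := by
    obtain ⟨a, b, hab⟩ := L₀.not_trivial
    exact ⟨a, b, by rintro rfl; exact hab (L₀.le_refl a)⟩
  have hmem : L₀ ∈ COrdRel G ⊥ := by
    refine ⟨hL₀', (Subgroup.eq_bot_iff_forall _).2 fun g hg => ?_⟩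
    exact hL₀ _ _ hg.2 hg.1
  have hsub : COrdRel G ⊥ ⊆ COrd G := fun L hL => hL.1
  refine ⟨?_, fun s hs hj => hs.encard hj⟩
  tfae_have 1 → 4 := by
    rintro ⟨L, hL⟩
    obtain ⟨S, hS⟩ := LeftPreorder.exists_isIsolatedCone hL
    exact hS.exists_isFull
  tfae_have 4 → 5 := fun ⟨s, hs, hj⟩ =>
    ⟨s, ⟨hs, fun t ht => hs.eq_of_not_hasAbelianJump hj ht⟩, hj⟩
  tfae_have 5 → 4 := fun ⟨s, ⟨hs, _⟩, hj⟩ => ⟨s, hs, hj⟩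
  tfae_have 4 → 7 := fun ⟨s, hs, hj⟩ => by
    rw [← Set.encard_lt_top_iff, (hs.encard hj).1]
    exact ENat.natCast_lt_top _
  tfae_have 7 → 6 := fun h => h.subset hsub
  tfae_have 7 → 3 := fun h L => LeftPreorder.isOpen_singleton_of_finite h L
  tfae_have 6 → 2 := fun h L => LeftPreorder.isOpen_singleton_of_finite h L
  tfae_have 3 → 2 := by
    intro h L
    have := (h (Set.inclusion hsub L)).preimage (continuous_inclusion hsub)
    convert this using 1
    ext L'
    simp [Set.inclusion, Subtype.ext_iff]
  tfae_have 2 → 1 := fun h => ⟨⟨L₀, hmem⟩, h _⟩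
  tfae_finish
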